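/- Directed lines $\ell$ in the plane have open left and right halfplanes $\ell^+$ and $\ell^-$. A *linear comparison tree* on inputs $P=(p_1,\dots,p_n)\in(\mathbb{R}^2)^n$ is a finite rooted binary tree with labeled leaves, in which every inner node $v$ asks a query "$p_i\in\ell_v^+$?". Here $\ell_v$ is (I) a fixed line, (II) a line in a fixed direction through an input point $p_j$, (III) a line through an input point $p_j$ and a fixed point, or (IV) the line through two input points $p_j,p_k$, where $i,j,k$ are distinct. The fixed data depend only on $v$. The evaluation on $P$ goes to the left child if the answer is yes and to the right child otherwise. The open region $\mathcal{R}_v$ of a node $v$ consists of those $P$ for which, at each node $u$ above $v$, the queried point lies in $\ell_u^+$ if the path to $v$ turns left at $u$ and in $\ell_u^-$ if it turns right. The root has depth $0$. A tree is *restricted* if all its inner nodes of depth at most $n^2$ use fixed lines (I). In this case the region of a node $v$ of depth at most $n^2$ is a product $\prod_i R_i$, where $R_i\subseteq\mathbb{R}^2$ is the intersection of the open halfplanes in which the queries above $v$ have placed $p_i$. Let $\mathcal{D}=\prod_{i=1}^n\mathcal{D}_i$ be a product of probability distributions on $\mathbb{R}^2$ that are continuous, in the sense that every line has probability $0$. A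 restricted tree is *entropy-sensitive* if for every inner node $v$ of depth at most $n^2$, with query "$p_j\in\ell_v^+$?" and region $\prod_i R_i$, the line $\ell_v$ is a halving line for $R_j$, that is, $\Pr_{p\sim\mathcal{D}_j}[p\in\ell_v^+\cap R_j]=\Pr_{p\sim\mathcal{D}_j}[p\in\ell_v^-\cap R_j]$. Let $d_{\mathcal{D}}(\mathcal{T})$ be the expected depth of the leaf of $\mathcal{T}$ reached on input $P\sim\mathcal{D}$. We say that $\mathcal{T}'$ *simulates* $\mathcal{T}$ if every leaf $w$ of $\mathcal{T}'$ carries the label of some leaf $v$ of $\mathcal{T}$ with $\mathcal{R}_w\subseteq\mathcal{R}_v$. There is an absolute constant $C$ such that the following hold for all $n$ and all such $\mathcal{D}$. 1. For every linear comparison tree $\mathcal{T}$ of worst-case depth at most $n^2$ there is a restricted tree $\mathcal{T}'$ that simulates $\mathcal{T}$ and has $d_{\mathcal{D}}(\mathcal{T}')\le C\,d_{\mathcal{D}}(\mathcal{T})$. 2. For every restricted tree $\mathcal{T}$ there is an entropy-sensitive tree $\mathcal{T}'$ that simulates $\mathcal{T}$ and has $d_{\mathcal{D}}(\mathcal{T}')\le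 C\,d_{\mathcal{D}}(\mathcal{T})$. 3. For every linear comparison tree $\mathcal{T}$ of worst-case depth at most $n^2$ there are a restricted tree $\mathcal{T}_1$ that simulates $\mathcal{T}$ and an entropy-sensitive tree $\mathcal{T}'$ that simulates $\mathcal{T}_1$, and hence $\mathcal{T}$, with $d_{\mathcal{D}}(\mathcal{T}_1)\le C\,d_{\mathcal{D}}(\mathcal{T})$ and $d_{\mathcal{D}}(\mathcal{T}')\le C\,d_{\mathcal{D}}(\mathcal{T})$. -/

import Mathlib

open MeasureTheory
open scoped NNReal ENNReal

namespace LinComp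

/-- The plane (measure and coordinates only, no norm is used). -/
abbrev Plane := ℝ × ℝ

/-- An input `P = ⟨p_1, …, p_n⟩`. -/
abbrev Input (n : ℕ) := Fin n → Plane

/-- The two-dimensional cross product. -/
def cross (u v : Plane) : ℝ := u.1 * v.2 - u.2 * v.1

/-- A directed line, given by a point on it and a nonzero direction vector. -/
structure DirLine where
  base : Plane
  dir : Plane
  dir_ne : dir ≠ 0

namespace DirLine

/-- `ℓ⁺`, the open halfplane to the left of `ℓ`. -/
def left (ℓ : DirLine) : Set Plane := {p | 0 < cross ℓ.dir (p - ℓ.base)}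

/-- `ℓ⁻`, the open halfplane to the right of `ℓ`. -/
def right (ℓ : DirLine) : Set Plane := {p | cross ℓ.dir (p - ℓ.base) < 0}

/-- The points of `ℓ`. -/
def points (ℓ : DirLine) : Set Plane := {p | cross ℓ.dir (p - ℓ.base) = 0}

end DirLine

/-- A continuous planar distribution, in the weakest sense in which points on query lines
can be ignored: every line is a null set. In particular there are no atoms, and every
distribution with a density is continuous. -/
def ContinuousDist (μ : Measure Plane) : Prop := ∀ ℓ : DirLine, μ ℓ.points = 0

/-- `ℓ` is a halving line for `R` with respect to `μ`. -/
def IsHalving (μ : Measure Plane) (ℓ : DirLine) (R : Set Plane) : Prop :=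
  μ (ℓ.left ∩ R) = μ (ℓ.right ∩ R)

/-- A query `p_i ∈ ℓ⁺?`, where `ℓ` is a fixed line, the line in a fixed direction `u`
through the input point `p_j`, a line through `p_j` and a fixed point `q` (directed from `q` to
`p_j` if `fromFixed` is true and from `p_j` to `q` otherwise), or the line through the
input points `p_j` and `p_k`, directed from `p_j` to `p_k`. -/
inductive Query (n : ℕ) where
  | fixed (i : Fin n) (ℓ : DirLine)
  | slope (i j : Fin n) (hij : i ≠ j) (u : Plane) (hu : u ≠ 0)
  | point (i j : Fin n) (hij : i ≠ j) (q : Plane) (fromFixed : Bool)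
  | pair (i j k : Fin n) (hij : i ≠ j) (hik : i ≠ k) (hjk : j ≠ k)

namespace Query

variable {n : ℕ}

/-- Positive, negative or zero according as, on input `P`, the queried point is to the left of,
to the right of, or on the query line. -/
def side : Query n → Input n → ℝ
  | fixed i ℓ, P => cross ℓ.dir (P i - ℓ.base)
  | slope i j _ u _, P => cross u (P i - P j)
  | point i j _ q true, P => cross (P j - q) (P i - q)
  | point i j _ q false, P => cross (q - P j) (P i - P j)
  | pair i j k _ _ _, P => cross (P k - P j) (P i - P j)

/-- The inputs that follow the branch `b` strictly: `true` is the branch `p_i ∈ ℓ⁺`, `false` is the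
branch `p_i ∈ ℓ⁻`. -/
def branch (c : Query n) (b : Bool) : Set (Input n) :=
  if b = true then {P | 0 < c.side P} else {P | c.side P < 0}

/-- The query uses a fixed line. -/
def IsFixed (c : Query n) : Prop := ∃ i ℓ, c = fixed i ℓ

open Classical in
/-- The condition that following the branch `b` puts on the `i`-th point alone, for a query that
uses a fixed line. -/
noncomputable def cut : Query n → Bool → Fin n → Set Plane
  | fixed j ℓ, b, i => if i = j then (if b = true then ℓ.left else ℓ.right) else Set.univ
  | _, _, _ => Set.univ

end Query

/-- Finite linear comparison trees on `n` points, with leaves labeled by outcomes in `α`. The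
first subtree is entered if the answer to the query is yes. -/
inductive Tree (n : ℕ) (α : Type*) where
  | leaf (a : α)
  | node (c : Query n) (yes no : Tree n α)

namespace Tree

variable {n : ℕ} {α : Type*}

/-- The worst-case depth. -/
def height : Tree n α → ℕ
  | leaf _ => 0
  | node _ y z => max y.height z.height + 1

/-- Nodes are given by their addresses, i.e. by the list of answers on the path from the root, so
the depth of a node is the length of its address. `T.sub v` is the subtree rooted at the
node `v`, and `none` if there is no such node. -/
def sub : Tree n α → List Bool → Option (Tree n α)
  | T, [] => some T
  | leaf _, _ :: _ => none
  | node _ y z, b :: v => if b = true then y.sub v else z.sub v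

/-- The open region of the inputs that reach the node `v`. -/
def region : Tree n α → List Bool → Set (Input n)
  | _, [] => Set.univ
  | leaf _, _ :: _ => ∅
  | node c y z, b :: v => c.branch b ∩ (if b = true then y.region v else z.region v)

/-- The planar region `R_i` of the `i`-th point at the node `v`: the intersection of all open
halfplanes which the fixed-line queries to `p_i` above `v` have put it in. If only fixed
lines are queried above `v`, the region of `v` is the product of these
sets (`region_eq_pi_cell`). -/
noncomputable def cell : Tree n α → List Bool → Fin n → Set Plane
  | _, [], _ => Set.univ
  | leaf _, _ :: _, _ => Set.univ
  | node c y z, b :: v, i => c.cut b i ∩ (if b = true then y.cell v i else z.cell v i)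

/-- All nodes of depth at most `n²` query fixed lines. -/
def Restricted (T : Tree n α) : Prop :=
  ∀ (v : List Bool) (c : Query n) (y z : Tree n α),
    v.length ≤ n ^ 2 → T.sub v = some (node c y z) → c.IsFixed

/-- A restricted tree in which every query line at depth at most `n²` is a halving line for the
current region of the queried point. -/
def EntropySensitive (D : Fin n → Measure Plane) (T : Tree n α) : Prop :=
  T.Restricted ∧
    ∀ (v : List Bool) (j : Fin n) (ℓ : DirLine) (y z : Tree n α),
      v.length ≤ n ^ 2 → T.sub v = some (node (Query.fixed j ℓ) y z) →
        IsHalving (D j) ℓ (T.cell v j)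

/-- `T'` computes what `T` computes: every leaf of `T'` carries the label of a leaf of `T` whose
region contains its own region. So labels that are valid for all inputs that
reach them in `T` are so in `T'`. -/
def Simulates (T' T : Tree n α) : Prop :=
  ∀ (w : List Bool) (a : α), T'.sub w = some (leaf a) →
    ∃ v : List Bool, T.sub v = some (leaf a) ∧ T'.region w ⊆ T.region v

open Classical in
/-- The leaf reached by the evaluation of `T` on `P`. -/
noncomputable def leafReached : Tree n α → Input n → List Bool
  | leaf _, _ => []
  | node c y z, P =>
      if 0 < c.side P then true :: y.leafReached P else false :: z.leafReached P

/-- The expected depth of the leaf that is reached by an input from the product distribution. -/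
noncomputable def expectedDepth (D : Fin n → Measure Plane) (T : Tree n α) : ℝ≥0∞ :=
  ∫⁻ P, ((T.leafReached P).length : ℝ≥0∞) ∂(Measure.pi D)

theorem region_eq_pi_cell (T : Tree n α) (v : List Bool) (S : Tree n α) (hv : T.sub v = some S)
    (h : ∀ (u : List Bool) (c : Query n) (y z : Tree n α),
      u <+: v → u ≠ v → T.sub u = some (node c y z) → c.IsFixed) :
    T.region v = Set.univ.pi (T.cell v) := by
  induction v generalizing T with
  | nil => ext P; simp [region, cell]
  | cons b v ih =>
    cases T with
    | leaf a => simp [sub] at hv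
    | node c y z =>
      obtain ⟨j, ℓ, rfl⟩ := h [] c y z (List.nil_prefix) (by simp) rfl
      have key : ∀ X : Tree n α, X.sub v = some S →
          (∀ u, (node (Query.fixed j ℓ) y z).sub (b :: u) = X.sub u) →
          X.region v = Set.univ.pi (X.cell v) := fun X hX hs =>
        ih X hX fun u c' y' z' hu hne hsu =>
          h (b :: u) c' y' z' (by simpa using hu) (by simpa using hne) (by rw [hs, hsu])
      ext P
      cases b with
      | true =>
        have := Set.ext_iff.1 (key y (by simpa [sub] using hv) (by intro u; simp [sub])) P
        simp only [Set.mem_pi, Set.mem_univ, true_implies] at this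
        simp only [region, cell, Query.branch, Query.side, Query.cut, if_true, Set.mem_inter_iff,
          Set.mem_ofPred_eq, this, Set.mem_pi, Set.mem_univ, true_implies, forall_and]
        refine and_congr_left fun _ => ⟨fun hP i => ?_, fun hP => by simpa [DirLine.left] using hP j⟩
        split_ifs with hi
        · subst hi; exact hP
        · trivial
      | false =>
        have := Set.ext_iff.1 (key z (by simpa [sub] using hv) (by intro u; simp [sub])) P
        simp only [Set.mem_pi, Set.mem_univ, true_implies] at this
        simp only [region, cell, Query.branch, Query.side, Query.cut, Bool.false_eq_true, if_false,
          Set.mem_inter_iff, Set.mem_ofPred_eq, this, Set.mem_pi, Set.mem_univ, true_implies,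
          forall_and]
        refine and_congr_left fun _ =>
          ⟨fun hP i => ?_, fun hP => by simpa [DirLine.right] using hP j⟩
        split_ifs with hi
        · subst hi; exact hP
        · trivial

end Tree

end LinComp

/-! ### Halving and quartering continuous measures in the plane. -/

namespace LinComp

open Filter Topology

/-! A query is replaced by a few cheaper ones that decide it with constant probability; if they
fail, it is asked again on the smaller region. Fixed lines keep the region a product of cells, so
the conditioned inputs remain independent and continuous, and the lines below can be chosen anew for
the current cells.

Let `q` be a fixed point. A line of fixed direction through `p_j`: the parallel halving line for
`p_i` separates `p_i` from `p_j` with probability 1/2. The line through `p_j` and `q`: two lines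
through `q` bound double wedges of half the mass of `p_i`, and the orientation of `q, p_j, p_i` is
known once `p_i` and `p_j` lie in different double wedges. The line through `p_j` and `p_k`: two
lines through a suitable `q` quarter the mass of `p_i`; generically the line misses one of the four
wedges, one point query and two slope queries tell which, and `p_i` lies in it with probability 1/4.

The accounting uses the potential `Query.cost` with weights 1, 4, 8, 72. They satisfy 1+1 = 4/2, 4·1
= 8/2 and 8+4+4+1+1 = 72/4, so a replacement at the root does not raise the expected cost
(`simulates_probe_and_lintegral_le`). Induction on the depth (`restrictsAtCost`) gives the factor
72; whatever remains below the prescribed depth is kept as it is.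

For entropy-sensitivity, each query line is replaced by its parallel that halves the current cell.
One of the two new halfplanes lies inside an old one, so half of the mass is decided at once, and
the factor is 2 (`exists_halvingTo`). -/

theorem tendsto_measureReal_pos {ι : Type*} {l : Filter ι} [l.IsCountablyGenerated]
    (ν : Measure Plane) [IsFiniteMeasure ν] {f : ι → Plane → ℝ} {A : Set Plane}
    (hm : ∀ t, Measurable (f t)) (hA : MeasurableSet A)
    (h : ∀ᵐ p ∂ν, ∀ᶠ t in l, 0 < f t p ↔ p ∈ A) :
    Tendsto (fun t => ν.real {p | 0 < f t p}) l (𝓝 (ν.real A)) :=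
  (ENNReal.tendsto_toReal (measure_ne_top ν A)).comp
    (tendsto_measure_of_ae_tendsto_indicator_of_isFiniteMeasure l hA
      (fun t => measurableSet_lt measurable_const (hm t)) h)

theorem tendsto_measureReal_pos_zero {ι : Type*} {l : Filter ι} [l.IsCountablyGenerated]
    (ν : Measure Plane) [IsFiniteMeasure ν] {f : ι → Plane → ℝ} (hm : ∀ t, Measurable (f t))
    (h : ∀ᵐ p ∂ν, ∀ᶠ t in l, f t p ≤ 0) :
    Tendsto (fun t => ν.real {p | 0 < f t p}) l (𝓝 0) := by
  simpa using tendsto_measureReal_pos ν hm MeasurableSet.empty (h.mono fun p hp =>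
    hp.mono fun t ht => iff_of_false ht.not_gt (Set.notMem_empty p))

/-- Near `t`, only points on the null zero set of `f t` can keep changing sides, so the indicators
converge almost everywhere. -/
theorem continuous_measureReal_pos {X : Type*} [TopologicalSpace X] [FirstCountableTopology X]
    (ν : Measure Plane) [IsFiniteMeasure ν] {f : X → Plane → ℝ}
    (hc : ∀ p, Continuous fun t => f t p) (hm : ∀ t, Measurable (f t))
    (h0 : ∀ t, ∀ᵐ p ∂ν, f t p ≠ 0) : Continuous fun t => ν.real {p | 0 < f t p} := by
  refine continuous_iff_continuousAt.2 fun t => ?_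
  refine tendsto_measureReal_pos ν hm (measurableSet_lt measurable_const (hm t)) ?_
  filter_upwards [h0 t] with p hp
  rcases lt_or_gt_of_ne hp with h | h
  · filter_upwards [(hc p).continuousAt.eventually_lt continuousAt_const h] with s hs
    simp [hs.not_gt, h.not_gt]
  · filter_upwards [continuousAt_const.eventually_lt (hc p).continuousAt h] with s hs
    simp [hs, h]

theorem natCast_mul_measure_eq {ν : Measure Plane} [IsFiniteMeasure ν] {A : Set Plane} (k : ℕ)
    (h : k * ν.real A = ν.real Set.univ) : (k : ℝ≥0∞) * ν A = ν Set.univ := by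
  rw [← ENNReal.toReal_eq_toReal_iff' (by finiteness) (by finiteness), ENNReal.toReal_mul]
  simpa [Measure.real] using h

theorem ContinuousDist.restrict {ν : Measure Plane} (hν : ContinuousDist ν) (R : Set Plane) :
    ContinuousDist (ν.restrict R) := fun ℓ =>
  le_antisymm ((Measure.restrict_apply_le _ _).trans_eq (hν ℓ)) bot_le

theorem ContinuousDist.ae_cross_ne {ν : Measure Plane} (hν : ContinuousDist ν) {u : Plane}
    (hu : u ≠ 0) (q : Plane) : ∀ᵐ p ∂ν, cross u (p - q) ≠ 0 := by
  have := hν ⟨q, u, hu⟩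
  rw [ae_iff]
  simpa [DirLine.points] using this

theorem ContinuousDist.ae_linear_ne {ν : Measure Plane} (hν : ContinuousDist ν) {a b : ℝ}
    (hab : (a, b) ≠ (0 : ℝ × ℝ)) (c : ℝ) : ∀ᵐ p ∂ν, a * p.1 + b * p.2 + c ≠ 0 := by
  have h2 : a ^ 2 + b ^ 2 ≠ 0 := by
    intro h
    apply hab
    have ha : a = 0 := by nlinarith [sq_nonneg a, sq_nonneg b]
    have hb : b = 0 := by nlinarith [sq_nonneg a, sq_nonneg b]
    simp [ha, hb]
  have hu : ((b, -a) : Plane) ≠ 0 := by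
    intro h
    apply hab
    simp only [Prod.mk_eq_zero, neg_eq_zero] at h
    simp [h.1, h.2]
  -- The base point is the foot of the perpendicular from the origin.
  filter_upwards [hν.ae_cross_ne hu (-c * a / (a ^ 2 + b ^ 2), -c * b / (a ^ 2 + b ^ 2))] with p hp
  intro h
  apply hp
  simp only [cross, Prod.fst_sub, Prod.snd_sub]
  field_simp
  linear_combination (a ^ 2 + b ^ 2) * h

@[fun_prop]
theorem continuous_cross {X : Type*} [TopologicalSpace X] {f g : X → Plane} (hf : Continuous f)
    (hg : Continuous g) : Continuous fun x => cross (f x) (g x) := by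
  unfold cross
  fun_prop

theorem DirLine.measurableSet_left (ℓ : DirLine) : MeasurableSet ℓ.left :=
  (isOpen_lt continuous_const (by fun_prop)).measurableSet

theorem DirLine.measurableSet_right (ℓ : DirLine) : MeasurableSet ℓ.right :=
  (isOpen_lt (by fun_prop) continuous_const).measurableSet

theorem ContinuousDist.measure_left_add_right {ν : Measure Plane} (hν : ContinuousDist ν)
    (ℓ : DirLine) : ν ℓ.left + ν ℓ.right = ν Set.univ := by
  rw [← measure_union _ ℓ.measurableSet_right]
  · refine measure_congr (eventuallyEq_set.2 ?_)
    filter_upwards [hν.ae_cross_ne ℓ.dir_ne ℓ.base] with p hp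
    exact iff_of_true (lt_or_gt_of_ne hp).symm trivial
  · exact Set.disjoint_left.2 fun p (hp : 0 < cross _ _) (hp' : cross _ _ < 0) => lt_asymm hp hp'

/-- The positive mass varies continuously from everything at `-∞` to nothing at `+∞`, so the
intermediate value theorem applies. -/
theorem exists_halving_parameter (ν : Measure Plane) [IsFiniteMeasure ν] {f : ℝ → Plane → ℝ}
    (hf : Continuous (Function.uncurry f)) (h0 : ∀ t, ∀ᵐ p ∂ν, f t p ≠ 0)
    (htop : ∀ᵐ p ∂ν, ∀ᶠ t in atTop, f t p ≤ 0) (hbot : ∀ᵐ p ∂ν, ∀ᶠ t in atBot, 0 < f t p) :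
    ∃ t, 2 * ν {p | 0 < f t p} = ν Set.univ ∧ 2 * ν {p | 0 < f t p}ᶜ = ν Set.univ := by
  have hm : ∀ t, Measurable (f t) := fun t =>
    (show Continuous (f t) from hf.comp (Continuous.prodMk_right t)).measurable
  have hcont : Continuous fun t => ν.real {p | 0 < f t p} :=
    continuous_measureReal_pos ν (fun p => hf.comp (Continuous.prodMk_left p)) hm h0
  have hbot' : Tendsto (fun t => ν.real {p | 0 < f t p}) atBot (𝓝 (ν.real Set.univ)) :=
    tendsto_measureReal_pos ν hm MeasurableSet.univ
      (hbot.mono fun p hp => hp.mono fun t ht => iff_of_true ht trivial)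
  obtain ⟨t, ht⟩ : ∃ t, ν.real {p | 0 < f t p} = ν.real Set.univ / 2 := by
    -- Cells of mass zero do occur; for them the limits give no strict inequalities.
    rcases (measureReal_nonneg (μ := ν) (s := Set.univ)).eq_or_lt with h | h
    · refine ⟨0, ?_⟩
      have : ν.real {p | 0 < f 0 p} ≤ ν.real Set.univ := measureReal_mono (Set.subset_univ _)
      rw [← h] at this ⊢
      simpa using le_antisymm this measureReal_nonneg
    · exact mem_range_of_exists_le_of_exists_ge hcont
        ((tendsto_measureReal_pos_zero ν hm htop).eventually_le_const (half_pos h)).exists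
        (hbot'.eventually_const_le (half_lt_self h)).exists
  refine ⟨t, natCast_mul_measure_eq 2 ?_, natCast_mul_measure_eq 2 ?_⟩
  · rw [ht]; push_cast; ring
  · rw [measureReal_compl (measurableSet_lt measurable_const (hm t)), ht]; push_cast; ring

/-- Every finite measure without charged lines has a halving line in each direction. -/
theorem exists_halving_line (ν : Measure Plane) [IsFiniteMeasure ν] (hν : ContinuousDist ν)
    (u : Plane) (hu : u ≠ 0) :
    ∃ ℓ : DirLine, ℓ.dir = u ∧ 2 * ν ℓ.left = ν Set.univ ∧ 2 * ν ℓ.right = ν Set.univ := by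
  have hu2 : u.1 ^ 2 + u.2 ^ 2 ≠ 0 := by
    intro h
    exact hu (Prod.ext (by simpa using (by nlinarith [sq_nonneg u.1, sq_nonneg u.2] : u.1 = 0))
      (by simpa using (by nlinarith [sq_nonneg u.1, sq_nonneg u.2] : u.2 = 0)))
  -- The base point is chosen so that its cross product with `u` is `t`.
  let ℓ : ℝ → DirLine := fun t =>
    ⟨(-u.2 * t / (u.1 ^ 2 + u.2 ^ 2), u.1 * t / (u.1 ^ 2 + u.2 ^ 2)), u, hu⟩
  have hl : ∀ t p, cross u (p - (ℓ t).base) = cross u p - t := fun t p => by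
    simp only [ℓ, cross, Prod.fst_sub, Prod.snd_sub]
    field_simp
    ring
  obtain ⟨t, ht, -⟩ := exists_halving_parameter ν (f := fun t p => cross u p - t)
    (by simp only [Function.uncurry_def]; fun_prop)
    (fun t => by simpa only [hl] using hν.ae_cross_ne hu (ℓ t).base)
    (ae_of_all _ fun p => (eventually_ge_atTop (cross u p)).mono fun t ht => sub_nonpos.2 ht)
    (ae_of_all _ fun p => (eventually_lt_atBot (cross u p)).mono fun t ht => sub_pos.2 ht)
  have h2 : 2 * ν (ℓ t).left = ν Set.univ := by
    rw [← ht]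
    congr 2
    ext p
    exact iff_of_eq (congrArg (0 < ·) (hl t p))
  refine ⟨ℓ t, rfl, h2, ?_⟩
  have h3 := hν.measure_left_add_right (ℓ t)
  rw [← h2, two_mul, ENNReal.add_right_inj (measure_ne_top ν _)] at h3
  rw [h3, h2]

/-- Through each point there is a line that, together with the horizontal line through this point,
bounds a double wedge of half of the mass. -/
theorem exists_halving_wedge (ν : Measure Plane) [IsFiniteMeasure ν] (hν : ContinuousDist ν)
    (q : Plane) :
    ∃ t : ℝ, 2 * ν {p | 0 < cross (1, 0) (p - q) * cross (-t, 1) (p - q)} = ν Set.univ ∧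
      2 * ν {p | 0 < cross (1, 0) (p - q) * cross (-t, 1) (p - q)}ᶜ = ν Set.univ := by
  have hy : ∀ᵐ p ∂ν, 0 < (p - q).2 ^ 2 := by
    filter_upwards [hν.ae_cross_ne (u := (1, 0)) (by simp) q] with p hp
    have : (p - q).2 ≠ 0 := by simpa [cross] using hp
    positivity
  -- Off the horizontal line through `q`, the product is affine in `t` with negative slope.
  have hf : ∀ (t : ℝ) (p : Plane), cross (1, 0) (p - q) * cross (-t, 1) (p - q) =
      -((p - q).1 * (p - q).2) - t * (p - q).2 ^ 2 := fun t p => by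
    simp only [cross]; ring
  refine exists_halving_parameter ν
    (f := fun t p => cross (1, 0) (p - q) * cross (-t, 1) (p - q)) ?_ (fun t => ?_) ?_ ?_
  · simp only [Function.uncurry_def]; fun_prop
  · filter_upwards [hν.ae_cross_ne (u := (1, 0)) (by simp) q,
      hν.ae_cross_ne (u := (-t, 1)) (by simp) q] with p h1 h2
    exact mul_ne_zero h1 h2
  · filter_upwards [hy] with p hp
    filter_upwards [eventually_ge_atTop (-((p - q).1 * (p - q).2) / (p - q).2 ^ 2)] with t ht
    rw [div_le_iff₀ hp] at ht
    rw [hf]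
    linarith
  · filter_upwards [hy] with p hp
    filter_upwards [eventually_lt_atBot (-((p - q).1 * (p - q).2) / (p - q).2 ^ 2)] with t ht
    rw [lt_div_iff₀ hp] at ht
    rw [hf]
    linarith

/-- Two functions that decrease in the height of a line and depend monotonically, in opposite
senses, on its slope take the values `a` and `b` simultaneously. -/
theorem exists_common_level {F G : ℝ × ℝ → ℝ} {a b : ℝ} (hF : Continuous F) (hG : Continuous G)
    (hFs : ∀ t, Antitone fun s => F (t, s)) (hGs : ∀ t, Monotone fun s => G (t, s))
    (hFt : ∀ s, Antitone fun t => F (t, s)) (hGt : ∀ s, Antitone fun t => G (t, s))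
    (hF0 : ∀ t, ∃ s, F (t, s) < a) (hG0 : ∀ t, ∃ s, G (t, s) < b)
    (hlow : ∃ t, a ≤ F (t, 0) ∧ b ≤ G (t, 0)) (hhigh : ∃ t, F (t, 0) < a ∧ G (t, 0) < b) :
    ∃ x, F x = a ∧ G x = b := by
  obtain ⟨t₁, h1F, h1G⟩ := hlow
  obtain ⟨t₂, h2F, h2G⟩ := hhigh
  obtain ⟨s₂, hs2⟩ := hF0 t₁
  obtain ⟨s₁, hs1⟩ := hG0 t₁
  -- Monotonicity makes this set bounded, so it has a point of greatest height `t`; the solution is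
  -- found at that height.
  let K : Set (ℝ × ℝ) := {x | a ≤ F x ∧ b ≤ G x ∧ t₁ ≤ x.1}
  have hKc : IsClosed K := (isClosed_le continuous_const hF).inter
    ((isClosed_le continuous_const hG).inter (isClosed_le continuous_const continuous_fst))
  have hKs : K ⊆ Set.Icc (t₁, s₁) (t₂, s₂) := by
    rintro ⟨t, s⟩ ⟨hf, hg, ht : t₁ ≤ t⟩
    have hs : s ≤ s₂ := by
      by_contra! h
      exact absurd ((hf.trans (hFt s ht)).trans (hFs t₁ h.le)) hs2.not_ge
    have hs' : s₁ ≤ s := by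
      by_contra! h
      exact absurd ((hg.trans (hGt s ht)).trans (hGs t₁ h.le)) hs1.not_ge
    refine ⟨⟨ht, hs'⟩, ⟨?_, hs⟩⟩
    by_contra! h
    change t₂ < t at h
    rcases le_total 0 s with h0 | h0
    · exact absurd ((hf.trans (hFs t h0)).trans (hFt 0 h.le)) h2F.not_ge
    · exact absurd ((hg.trans (hGs t h0)).trans (hGt 0 h.le)) h2G.not_ge
  have hK : IsCompact K := isCompact_Icc.of_isClosed_subset hKc hKs
  obtain ⟨⟨t, s⟩, ⟨hf, hg, ht⟩, hmax⟩ :=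
    hK.exists_isMaxOn ⟨(t₁, 0), h1F, h1G, le_rfl⟩ continuous_fst.continuousOn
  have hFc : Continuous fun s => F (t, s) := by fun_prop
  have hGc : Continuous fun s => G (t, s) := by fun_prop
  change t₁ ≤ t at ht
  obtain ⟨r, hrs, hr⟩ : ∃ r, s ≤ r ∧ F (t, r) = a := by
    have hss : s ≤ s₂ := (hKs ⟨hf, hg, ht⟩ : _).2.2
    obtain ⟨r, hr, h⟩ := intermediate_value_Icc' hss hFc.continuousOn
      ⟨(hFt s₂ ht).trans hs2.le, hf⟩
    exact ⟨r, hr.1, h⟩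
  obtain ⟨l, hls, hl⟩ : ∃ l, l ≤ s ∧ G (t, l) = b := by
    have hss : s₁ ≤ s := (hKs ⟨hf, hg, ht⟩ : _).1.2
    obtain ⟨r, hr, h⟩ := intermediate_value_Icc hss hGc.continuousOn
      ⟨(hGt s₁ ht).trans hs1.le, hg⟩
    exact ⟨r, hr.2, h⟩
  -- For slopes between `l` and `r` both levels are still attained or exceeded. At `l` the excess of
  -- `G` is zero, at `r` that of `F`, so in between the two excesses agree.
  obtain ⟨c, ⟨hlc, hcr⟩, hc⟩ := intermediate_value_Icc' (hls.trans hrs)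
    (f := fun s => (F (t, s) - a) - (G (t, s) - b)) (by fun_prop)
    (show (0 : ℝ) ∈ Set.Icc _ _ from
      ⟨by have := hGs t hrs; simp only at this ⊢; linarith,
        by have := hFs t hls; simp only at this ⊢; linarith⟩)
  have hFa : a ≤ F (t, c) := hr.symm.le.trans (hFs t hcr)
  have hGb : b ≤ G (t, c) := hl.symm.le.trans (hGs t hlc)
  rcases hFa.eq_or_lt with h | h
  · exact ⟨(t, c), h.symm, by simp only at hc; linarith⟩
  -- A common positive excess would survive a small increase of `t`, against maximality.
  · exfalso
    have h' : b < G (t, c) := by simp only at hc; linarith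
    have hF' : Continuous fun t => F (t, c) := by fun_prop
    have hG' : Continuous fun t => G (t, c) := by fun_prop
    have h1 : ∀ᶠ t' in 𝓝 t, a < F (t', c) :=
      continuousAt_const.eventually_lt hF'.continuousAt h
    have h2 : ∀ᶠ t' in 𝓝 t, b < G (t', c) :=
      continuousAt_const.eventually_lt hG'.continuousAt h'
    obtain ⟨t', ⟨hf', hg'⟩, htt⟩ :=
      (((h1.and h2).filter_mono nhdsWithin_le_nhds).and
        (self_mem_nhdsWithin (a := t) (s := Set.Ioi t))).exists
    have hmem : ((t', c) : ℝ × ℝ) ∈ K := ⟨hf'.le, hg'.le, ht.trans (le_of_lt htt)⟩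
    exact absurd (hmax hmem) (not_le_of_gt htt)

/-- A vertical line and a line of finite slope through one of its points cut each finite measure
without charged lines into four equal parts. -/
theorem exists_quartering (ν : Measure Plane) [IsFiniteMeasure ν] (hν : ContinuousDist ν) :
    ∃ (q : Plane) (s : ℝ), ∀ a b : Bool,
      4 * ν {p | decide (0 < cross (0, -1) (p - q)) = a ∧ decide (0 < cross (1, s) (p - q)) = b} =
        ν Set.univ := by
  rcases eq_or_ne (ν Set.univ) 0 with h0 | h0
  · refine ⟨0, 0, fun a b => ?_⟩
    rw [h0, measure_mono_null (Set.subset_univ _) h0, mul_zero]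
  have hpos : 0 < ν.real Set.univ := ENNReal.toReal_pos h0 (measure_ne_top _ _)
  obtain ⟨⟨⟨m, y⟩, u, hu⟩, rfl : u = (0, -1), hL, hR⟩ := exists_halving_line ν hν (0, -1) (by simp)
  let A : Set Plane := {p | 0 < p.1 - m}
  have hA : MeasurableSet A := measurableSet_lt measurable_const (by fun_prop)
  have hAm : ν.real A = ν.real Set.univ / 2 := by
    have : 2 * ν A = ν Set.univ := by
      rw [← hL]
      congr 2
      ext p
      simp [A, DirLine.left, cross]
    rw [Measure.real, Measure.real, ← this, ENNReal.toReal_mul]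
    simp
  have hAc : ν.real Aᶜ = ν.real Set.univ / 2 := by
    rw [measureReal_compl hA, hAm]; ring
  -- Positive above the line of slope `x.2` that meets the vertical halving line at height `x.1`.
  let f : ℝ × ℝ → Plane → ℝ := fun x p => p.2 - x.1 - x.2 * (p.1 - m)
  have hfm : ∀ x, Measurable (f x) := fun x => by
    have : Continuous (f x) := by fun_prop
    exact this.measurable
  have hset : ∀ x, MeasurableSet {p | 0 < f x p} := fun x =>
    measurableSet_lt measurable_const (hfm x)
  have hcont : ∀ B : Set Plane, Continuous fun x => (ν.restrict B).real {p | 0 < f x p} :=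
    fun B => continuous_measureReal_pos _ (fun p => by fun_prop) hfm fun x => by
      filter_upwards [(hν.restrict B).ae_linear_ne (a := -x.2) (b := 1) (by simp)
        (x.2 * m - x.1)] with p hp h
      apply hp
      simp only [f] at h
      linarith
  have hne : ∀ B : Set Plane, ∀ᵐ p ∂ν.restrict B, p.1 - m ≠ 0 := fun B => by
    filter_upwards [(hν.restrict B).ae_linear_ne (a := 1) (b := 0) (by simp) (-m)] with p hp h
    apply hp
    linarith
  have hmono : ∀ B : Set Plane, MeasurableSet B → ∀ x y, (∀ p ∈ B, f x p ≤ f y p) →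
      (ν.restrict B).real {p | 0 < f x p} ≤ (ν.restrict B).real {p | 0 < f y p} :=
    fun B hB x y h => by
      rw [measureReal_restrict_apply (hset _), measureReal_restrict_apply (hset _)]
      exact measureReal_mono fun p hp => ⟨lt_of_lt_of_le hp.1 (h p hp.2), hp.2⟩
  have hlow : ∀ B : Set Plane, Tendsto (fun t => (ν.restrict B).real {p | 0 < f (t, 0) p}) atBot
      (𝓝 (ν.real B)) := fun B => by
    rw [← measureReal_restrict_apply_univ (μ := ν) B]
    refine tendsto_measureReal_pos (ν.restrict B) (fun t => hfm (t, 0)) MeasurableSet.univ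
      (ae_of_all _ fun p => ?_)
    filter_upwards [eventually_lt_atBot p.2] with t ht
    simpa [f] using ht
  have hhigh : ∀ B : Set Plane, Tendsto (fun t => (ν.restrict B).real {p | 0 < f (t, 0) p}) atTop
      (𝓝 0) := fun B => by
    refine tendsto_measureReal_pos_zero (ν.restrict B) (fun t => hfm (t, 0))
      (ae_of_all _ fun p => ?_)
    filter_upwards [eventually_ge_atTop p.2] with t ht
    simpa [f] using ht
  have hF0 : ∀ t, Tendsto (fun s => (ν.restrict A).real {p | 0 < f (t, s) p}) atTop (𝓝 0) :=
    fun t => by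
      refine tendsto_measureReal_pos_zero (ν.restrict A) (fun s => hfm (t, s)) ?_
      filter_upwards [ae_restrict_mem hA] with p (hp : 0 < p.1 - m)
      filter_upwards [eventually_ge_atTop ((p.2 - t) / (p.1 - m))] with s hs
      rw [div_le_iff₀ hp] at hs
      simpa [f] using hs
  have hG0 : ∀ t, Tendsto (fun s => (ν.restrict Aᶜ).real {p | 0 < f (t, s) p}) atBot (𝓝 0) :=
    fun t => by
      refine tendsto_measureReal_pos_zero (ν.restrict Aᶜ) (fun s => hfm (t, s)) ?_
      filter_upwards [ae_restrict_mem hA.compl, hne Aᶜ] with p hp hp'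
      have hp2 : p.1 - m < 0 := lt_of_le_of_ne (not_lt.1 hp) hp'
      filter_upwards [eventually_le_atBot ((p.2 - t) / (p.1 - m))] with s hs
      rw [le_div_iff_of_neg hp2] at hs
      simpa [f] using hs
  have hq : 0 < ν.real Set.univ / 4 := by positivity
  have hq2 : ν.real Set.univ / 4 < ν.real Set.univ / 2 := by linarith
  -- The masses above the line on the right and on the left of the vertical one. A larger slope
  -- lowers the first and raises the second.
  let F : ℝ × ℝ → ℝ := fun x => (ν.restrict A).real {p | 0 < f x p}
  let G : ℝ × ℝ → ℝ := fun x => (ν.restrict Aᶜ).real {p | 0 < f x p}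
  have hFs : ∀ t, Antitone fun s => F (t, s) := fun t s s' h =>
    hmono A hA (t, s') (t, s) fun p (hp : 0 < p.1 - m) => by
      have := mul_le_mul_of_nonneg_right h hp.le
      simp only [f]; linarith
  have hGs : ∀ t, Monotone fun s => G (t, s) := fun t s s' h =>
    hmono Aᶜ hA.compl (t, s) (t, s') fun p hp => by
      have hp : p.1 - m ≤ 0 := not_lt.1 hp
      have := mul_le_mul_of_nonpos_right h hp
      simp only [f]; linarith
  have hFt : ∀ s, Antitone fun t => F (t, s) := fun s t t' h =>
    hmono A hA (t', s) (t, s) fun p _ => by simp only [f]; linarith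
  have hGt : ∀ s, Antitone fun t => G (t, s) := fun s t t' h =>
    hmono Aᶜ hA.compl (t', s) (t, s) fun p _ => by simp only [f]; linarith
  have hFG : ∃ t, ν.real Set.univ / 4 ≤ F (t, 0) ∧ ν.real Set.univ / 4 ≤ G (t, 0) :=
    (((hlow A).eventually_const_le (by rwa [hAm])).and
      ((hlow Aᶜ).eventually_const_le (by rwa [hAc]))).exists
  have hFG' : ∃ t, F (t, 0) < ν.real Set.univ / 4 ∧ G (t, 0) < ν.real Set.univ / 4 :=
    (((hhigh A).eventually_lt_const hq).and ((hhigh Aᶜ).eventually_lt_const hq)).exists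
  obtain ⟨⟨t, s⟩, hF, hG⟩ := exists_common_level (hcont A) (hcont Aᶜ) hFs hGs hFt hGt
    (fun t => ((hF0 t).eventually_lt_const hq).exists)
    (fun t => ((hG0 t).eventually_lt_const hq).exists) hFG hFG'
  let U : Set Plane := {p | 0 < f (t, s) p}
  have hU : MeasurableSet U := hset _
  rw [measureReal_restrict_apply hU] at hF hG
  have hF' : ν.real (Uᶜ ∩ A) = ν.real Set.univ / 4 := by
    have := measureReal_inter_add_sdiff (μ := ν) (s := A) hU
    rw [Set.inter_comm, hF, hAm, Set.sdiff_eq, Set.inter_comm] at this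
    linarith
  have hG' : ν.real (Uᶜ ∩ Aᶜ) = ν.real Set.univ / 4 := by
    have := measureReal_inter_add_sdiff (μ := ν) (s := Aᶜ) hU
    rw [Set.inter_comm, hG, hAc, Set.sdiff_eq, Set.inter_comm] at this
    linarith
  have h1 : ∀ p : Plane, 0 < cross (0, -1) (p - (m, t)) ↔ p ∈ A := fun p => by simp [cross, A]
  have h2 : ∀ p : Plane, 0 < cross (1, s) (p - (m, t)) ↔ p ∈ U := fun p => by
    simp [cross, U, f]
  refine ⟨(m, t), s, fun a b => natCast_mul_measure_eq 4 ?_⟩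
  simp only [h1, h2]
  have key : ν.real {p | decide (p ∈ A) = a ∧ decide (p ∈ U) = b} = ν.real Set.univ / 4 := by
    cases a <;> cases b
    · rw [← hG']; congr 1; ext p; simp [and_comm]
    · rw [← hG]; congr 1; ext p; simp [and_comm, U]
    · rw [← hF']; congr 1; ext p; simp [and_comm]
    · rw [← hF]; congr 1; ext p; simp [and_comm, U]
  have e : ν.real {p | decide (p ∈ A) = a ∧ decide (p ∈ U) = b} * 4 = ν.real Set.univ := by
    rw [key]; ring
  rw [mul_comm] at e
  exact_mod_cast e

end LinComp

/-! ### Relative simulation, weighted depth, and blocks of queries. -/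

namespace LinComp

variable {n : ℕ} {α : Type*}

namespace Query

theorem continuous_side (c : Query n) : Continuous c.side := by
  cases c with
  | fixed i ℓ => exact (by fun_prop : Continuous fun P : Input n => cross ℓ.dir (P i - ℓ.base))
  | slope i j _ u _ => exact (by fun_prop : Continuous fun P : Input n => cross u (P i - P j))
  | point i j _ q b =>
    cases b
    · exact (by fun_prop : Continuous fun P : Input n => cross (q - P j) (P i - P j))
    · exact (by fun_prop : Continuous fun P : Input n => cross (P j - q) (P i - q))
  | pair i j k _ _ _ =>
    exact (by fun_prop : Continuous fun P : Input n => cross (P k - P j) (P i - P j))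

@[simp]
theorem mem_branch_true (c : Query n) (P : Input n) : P ∈ c.branch true ↔ 0 < c.side P := by
  simp [branch]

@[simp]
theorem mem_branch_false (c : Query n) (P : Input n) : P ∈ c.branch false ↔ c.side P < 0 := by
  simp [branch]

theorem measurableSet_branch (c : Query n) (b : Bool) : MeasurableSet (c.branch b) := by
  cases b
  · simpa [branch] using (isOpen_lt c.continuous_side continuous_const).measurableSet
  · simpa [branch] using (isOpen_lt continuous_const c.continuous_side).measurableSet

theorem measurableSet_cut (c : Query n) (b : Bool) (i : Fin n) : MeasurableSet (c.cut b i) := by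
  cases c <;> simp only [cut, MeasurableSet.univ]
  split_ifs
  · exact DirLine.measurableSet_left _
  · exact DirLine.measurableSet_right _
  · exact MeasurableSet.univ

/-- A fixed-line query cuts a product of cells into products of cells, which is what preserves
independence in the inductions. -/
theorem pi_inter_cut (j : Fin n) (ℓ : DirLine) (b : Bool) (R : Fin n → Set Plane) :
    (Set.univ.pi fun i => R i ∩ (fixed j ℓ).cut b i) = Set.univ.pi R ∩ (fixed j ℓ).branch b := by
  ext P
  simp only [Set.mem_pi, Set.mem_univ, true_implies, Set.mem_inter_iff, forall_and,
    and_congr_right_iff]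
  intro _
  cases b
  · refine ⟨fun h => by simpa [cut, side, DirLine.right] using h j, fun h i => ?_⟩
    by_cases hi : i = j
    · subst hi; simpa [cut, side, DirLine.right] using h
    · simp [cut, hi]
  · refine ⟨fun h => by simpa [cut, side, DirLine.left] using h j, fun h i => ?_⟩
    by_cases hi : i = j
    · subst hi; simpa [cut, side, DirLine.left] using h
    · simp [cut, hi]

end Query

namespace Tree

/-- `T'` computes what `T` computes on the inputs in `G`. -/
def SimulatesOn (G : Set (Input n)) (T' T : Tree n α) : Prop :=
  ∀ (w : List Bool) (a : α), T'.sub w = some (leaf a) →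
    ∃ v : List Bool, T.sub v = some (leaf a) ∧ G ∩ T'.region w ⊆ T.region v

theorem simulatesOn_univ {T' T : Tree n α} : SimulatesOn Set.univ T' T ↔ T'.Simulates T := by
  simp [SimulatesOn, Simulates]

theorem SimulatesOn.refl (G : Set (Input n)) (T : Tree n α) : SimulatesOn G T T :=
  fun w _ h => ⟨w, h, Set.inter_subset_right⟩

theorem SimulatesOn.mono {G G' : Set (Input n)} (hG : G' ⊆ G) {T' T : Tree n α}
    (h : SimulatesOn G T' T) : SimulatesOn G' T' T := fun w a hw => by
  obtain ⟨v, hv, hv'⟩ := h w a hw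
  exact ⟨v, hv, fun P hP => hv' ⟨hG hP.1, hP.2⟩⟩

theorem SimulatesOn.trans {G : Set (Input n)} {T₁ T₂ T₃ : Tree n α} (h₁ : SimulatesOn G T₁ T₂)
    (h₂ : SimulatesOn G T₂ T₃) : SimulatesOn G T₁ T₃ := fun w a hw => by
  obtain ⟨v, hv, hv'⟩ := h₁ w a hw
  obtain ⟨u, hu, hu'⟩ := h₂ v a hv
  exact ⟨u, hu, fun P hP => hu' ⟨hP.1, hv' hP⟩⟩

theorem SimulatesOn.node {G : Set (Input n)} {c : Query n} {y z T : Tree n α}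
    (hy : SimulatesOn (G ∩ c.branch true) y T) (hz : SimulatesOn (G ∩ c.branch false) z T) :
    SimulatesOn G (node c y z) T := by
  rintro (_ | ⟨b, w⟩) a hw
  · simp [sub] at hw
  cases b
  · obtain ⟨v, hv, h⟩ := hz w a (by simpa [sub] using hw)
    exact ⟨v, hv, by simpa [region, Set.inter_assoc] using h⟩
  · obtain ⟨v, hv, h⟩ := hy w a (by simpa [sub] using hw)
    exact ⟨v, hv, by simpa [region, Set.inter_assoc] using h⟩

/-- A query whose answer is constant on `G` can be skipped there. -/
theorem SimulatesOn.of_subset_branch {G : Set (Input n)} {c : Query n} {X y z : Tree n α}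
    (b : Bool) (hG : G ⊆ c.branch b) (h : SimulatesOn G X (if b = true then y else z)) :
    SimulatesOn G X (Tree.node c y z) := fun w a hw => by
  obtain ⟨v, hv, hv'⟩ := h w a hw
  refine ⟨b :: v, by cases b <;> simpa [sub] using hv, fun P hP => ⟨hG hP.1, ?_⟩⟩
  cases b <;> exact hv' hP

/-- All nodes of depth less than `m` query fixed lines. -/
def RestrictedTo (m : ℕ) (T : Tree n α) : Prop :=
  ∀ (v : List Bool) (c : Query n) (y z : Tree n α),
    v.length < m → T.sub v = some (node c y z) → c.IsFixed

theorem restrictedTo_zero (T : Tree n α) : T.RestrictedTo 0 := fun _ _ _ _ h => by simp at h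

theorem restrictedTo_leaf (m : ℕ) (a : α) : (leaf a : Tree n α).RestrictedTo m := by
  rintro (_ | ⟨b, v⟩) c y z _ h <;> simp [sub] at h

theorem restricted_iff {T : Tree n α} : T.Restricted ↔ T.RestrictedTo (n ^ 2 + 1) := by
  simp [Restricted, RestrictedTo]

theorem RestrictedTo.mono {m k : ℕ} (h : k ≤ m) {T : Tree n α} (hT : T.RestrictedTo m) :
    T.RestrictedTo k := fun v c y z hv => hT v c y z (hv.trans_le h)

theorem restrictedTo_succ_node {m : ℕ} {c : Query n} {y z : Tree n α} :
    (node c y z).RestrictedTo (m + 1) ↔ c.IsFixed ∧ y.RestrictedTo m ∧ z.RestrictedTo m := by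
  constructor
  · exact fun h => ⟨h [] c y z (by simp) rfl,
      fun v c' y' z' hv hs => h (true :: v) c' y' z' (by simpa using hv) (by simpa [sub] using hs),
      fun v c' y' z' hv hs => h (false :: v) c' y' z' (by simpa using hv) (by simpa [sub] using hs)⟩
  · rintro ⟨hc, hy, hz⟩ (_ | ⟨_ | _, v⟩) c' y' z' hv hs
    · simp only [sub, Option.some.injEq, node.injEq] at hs
      exact hs.1 ▸ hc
    · exact hz v c' y' z' (by simpa using hv) (by simpa [sub] using hs)
    · exact hy v c' y' z' (by simpa using hv) (by simpa [sub] using hs)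

/-- All query lines at depth less than `m` halve the current cells, where `R` are the cells at the
root. -/
def HalvingTo (D : Fin n → Measure Plane) (m : ℕ) (R : Fin n → Set Plane) (T : Tree n α) : Prop :=
  ∀ (v : List Bool) (j : Fin n) (ℓ : DirLine) (y z : Tree n α),
    v.length < m → T.sub v = some (node (Query.fixed j ℓ) y z) →
      IsHalving (D j) ℓ (R j ∩ T.cell v j)

theorem entropySensitive_iff {D : Fin n → Measure Plane} {T : Tree n α} :
    T.EntropySensitive D ↔
      T.RestrictedTo (n ^ 2 + 1) ∧ T.HalvingTo D (n ^ 2 + 1) fun _ => Set.univ := by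
  simp [EntropySensitive, HalvingTo, restricted_iff]

theorem halvingTo_zero (D : Fin n → Measure Plane) (R : Fin n → Set Plane) (T : Tree n α) :
    T.HalvingTo D 0 R := fun _ _ _ _ _ h => by simp at h

theorem halvingTo_leaf (D : Fin n → Measure Plane) (m : ℕ) (R : Fin n → Set Plane) (a : α) :
    (leaf a : Tree n α).HalvingTo D m R := by
  rintro (_ | ⟨b, v⟩) j ℓ y z _ h <;> simp [sub] at h

theorem HalvingTo.node {D : Fin n → Measure Plane} {m : ℕ} {R : Fin n → Set Plane} {j : Fin n}
    {ℓ : DirLine} {y z : Tree n α} (h : IsHalving (D j) ℓ (R j))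
    (hy : y.HalvingTo D m fun i => R i ∩ (Query.fixed j ℓ).cut true i)
    (hz : z.HalvingTo D m fun i => R i ∩ (Query.fixed j ℓ).cut false i) :
    (Tree.node (Query.fixed j ℓ) y z).HalvingTo D (m + 1) R := by
  rintro (_ | ⟨_ | _, v⟩) j' ℓ' y' z' hv hs
  · simp only [sub, Option.some.injEq, node.injEq, Query.fixed.injEq] at hs
    obtain ⟨⟨rfl, rfl⟩, -⟩ := hs
    simpa [cell] using h
  · simpa [cell, Set.inter_assoc] using
      hz v j' ℓ' y' z' (by simpa using hv) (by simpa [sub] using hs)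
  · simpa [cell, Set.inter_assoc] using
      hy v j' ℓ' y' z' (by simpa using hv) (by simpa [sub] using hs)

open Classical in
/-- The sum of the weights of the queries that are made on the input `P`. -/
noncomputable def weight (ω : Query n → ℝ≥0∞) : Tree n α → Input n → ℝ≥0∞
  | leaf _, _ => 0
  | node c y z, P => ω c + if 0 < c.side P then y.weight ω P else z.weight ω P

theorem weight_one (T : Tree n α) (P : Input n) :
    T.weight (fun _ => 1) P = ((T.leafReached P).length : ℝ≥0∞) := by
  induction T with
  | leaf a => simp [weight, leafReached]
  | node c y z hy hz =>
    simp only [weight, leafReached]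
    split_ifs <;> simp [hy, hz, add_comm]

theorem expectedDepth_eq (D : Fin n → Measure Plane) (T : Tree n α) :
    T.expectedDepth D = ∫⁻ P, T.weight (fun _ => 1) P ∂Measure.pi D := by
  simp [expectedDepth, weight_one]

theorem weight_le_mul {ω : Query n → ℝ≥0∞} {C : ℝ≥0∞} (h : ∀ c, ω c ≤ C) (T : Tree n α)
    (P : Input n) : T.weight ω P ≤ C * T.weight (fun _ => 1) P := by
  induction T with
  | leaf a => simp [weight]
  | node c y z hy hz =>
    simp only [weight, mul_add, mul_one]
    split_ifs
    · exact add_le_add (h c) hy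
    · exact add_le_add (h c) hz

theorem weight_mono {ω ω' : Query n → ℝ≥0∞} (h : ∀ c, ω c ≤ ω' c) (T : Tree n α)
    (P : Input n) : T.weight ω P ≤ T.weight ω' P := by
  induction T with
  | leaf a => simp [weight]
  | node c y z hy hz =>
    simp only [weight]
    split_ifs
    · exact add_le_add (h c) hy
    · exact add_le_add (h c) hz

/-- The tree that makes all the queries in a list and continues according to the answers. -/
def probe : List (Query n) → (List Bool → Tree n α) → Tree n α
  | [], k => k []
  | c :: cs, k => node c (probe cs fun bs => k (true :: bs)) (probe cs fun bs => k (false :: bs))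

open Classical in
/-- The answers to the queries in a list, in the evaluation on `P`. -/
noncomputable def answers (cs : List (Query n)) (P : Input n) : List Bool :=
  cs.map fun c => decide (0 < c.side P)

theorem weight_probe (ω : Query n → ℝ≥0∞) (cs : List (Query n)) (k : List Bool → Tree n α)
    (P : Input n) :
    (probe cs k).weight ω P = (cs.map ω).sum + (k (answers cs P)).weight ω P := by
  induction cs generalizing k with
  | nil => simp [probe, answers]
  | cons c cs ih =>
    simp only [probe, weight, ih, answers, List.map_cons, List.sum_cons, add_assoc]
    split_ifs with h <;> simp [h]

theorem simulatesOn_probe {G : Set (Input n)} {cs : List (Query n)} {k : List Bool → Tree n α}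
    {T : Tree n α} (h : ∀ bs : List Bool, bs.length = cs.length →
      SimulatesOn (G ∩ {P | List.Forall₂ (fun c b => P ∈ c.branch b) cs bs}) (k bs) T) :
    SimulatesOn G (probe cs k) T := by
  induction cs generalizing k G with
  | nil => simpa [probe] using h [] rfl
  | cons c cs ih =>
    refine SimulatesOn.node (ih fun bs hbs => ?_) (ih fun bs hbs => ?_)
    · have := h (true :: bs) (by simpa using hbs)
      simpa only [List.forall₂_cons, Set.ofPred_and, ← Set.inter_assoc, Set.ofPred_mem_eq] using this
    · have := h (false :: bs) (by simpa using hbs)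
      simpa only [List.forall₂_cons, Set.ofPred_and, ← Set.inter_assoc, Set.ofPred_mem_eq] using this

end Tree

end LinComp

/-! ### Replacing a single query by cheaper ones. -/

namespace LinComp

variable {n : ℕ} {α : Type*}

/-- `x` is positive if `b` is true, and negative otherwise. -/
def HasSign : Bool → ℝ → Prop
  | true, x => 0 < x
  | false, x => x < 0

theorem HasSign.mul {a b : Bool} {x y : ℝ} (hx : HasSign a x) (hy : HasSign b y) :
    HasSign (a == b) (x * y) := by
  cases a <;> cases b
  · exact mul_pos_of_neg_of_neg hx hy
  · exact mul_neg_of_neg_of_pos hx hy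
  · exact mul_neg_of_pos_of_neg hx hy
  · exact mul_pos hx hy

theorem HasSign.neg {a : Bool} {x : ℝ} (hx : HasSign a x) : HasSign (!a) (-x) := by
  cases a <;> simpa [HasSign] using hx

theorem HasSign.add {a : Bool} {x y : ℝ} (hx : HasSign a x) (hy : HasSign a y) :
    HasSign a (x + y) := by
  cases a <;> simp only [HasSign] at * <;> linarith

theorem hasSign_of_ne_zero {x : ℝ} (hx : x ≠ 0) : HasSign (decide (0 < x)) x := by
  rcases lt_or_gt_of_ne hx with h | h
  · simp [HasSign, h, h.not_gt]
  · simp [HasSign, h]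

theorem Query.mem_branch_iff {c : Query n} {b : Bool} {P : Input n} :
    P ∈ c.branch b ↔ HasSign b (c.side P) := by
  cases b <;> simp [HasSign]

namespace Tree

theorem measurableSet_answers (cs : List (Query n)) (p : List Bool → Prop) :
    MeasurableSet {P | p (answers cs P)} := by
  induction cs generalizing p with
  | nil => simp [answers]
  | cons c cs ih =>
    have h : {P | p (answers (c :: cs) P)} =
        (c.branch true ∩ {P | p (true :: answers cs P)}) ∪
          ((c.branch true)ᶜ ∩ {P | p (false :: answers cs P)}) := by
      ext P
      by_cases hP : 0 < c.side P <;> simp [answers, hP]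
    rw [h]
    exact ((c.measurableSet_branch true).inter (ih fun bs => p (true :: bs))).union
      ((c.measurableSet_branch true).compl.inter (ih fun bs => p (false :: bs)))

theorem forall₂_answers {cs : List (Query n)} {P : Input n} (h : ∀ c ∈ cs, c.side P ≠ 0) :
    List.Forall₂ (fun c b => P ∈ c.branch b) cs (answers cs P) := by
  induction cs with
  | nil => simp [answers]
  | cons c cs ih =>
    simp only [List.mem_cons, forall_eq_or_imp] at h
    refine List.Forall₂.cons ?_ (ih h.2)
    exact Query.mem_branch_iff.2 (hasSign_of_ne_zero h.1)

/-- Fubini in one coordinate: an estimate for `p_i` that is uniform in the other points can be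
integrated over them. -/
theorem mul_measure_pi_le {μ : Fin n → Measure Plane} [∀ i, IsFiniteMeasure (μ i)] (i : Fin n)
    {S : Set (Input n)} (hS : MeasurableSet S) (a b : ℝ≥0∞)
    (h : ∀ P : Input n, a * μ i Set.univ ≤ b * μ i {x | Function.update P i x ∈ S}) :
    a * Measure.pi μ Set.univ ≤ b * Measure.pi μ S := by
  have key := lintegral_le_of_lmarginal_le (μ := μ) {i} (f := fun _ => a)
    (g := S.indicator fun _ => b) measurable_const (measurable_const.indicator hS) (by
      rw [lmarginal_singleton, lmarginal_singleton]
      intro P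
      have hu : MeasurableSet {x | Function.update P i x ∈ S} := measurable_update P hS
      change ∫⁻ _, a ∂μ i ≤ ∫⁻ x, {x | Function.update P i x ∈ S}.indicator (fun _ => b) x ∂μ i
      rw [lintegral_indicator_const hu, lintegral_const]
      exact h P)
  rwa [lintegral_indicator_const hS, lintegral_const] at key

/-- The continuation after a list of queries that may or may not have decided the query `c`. -/
def resume (c : Query n) (y z : Tree n α) : Option Bool → Tree n α
  | none => node c y z
  | some true => y
  | some false => z

/-- A query can be replaced by cheaper ones that are likely enough to decide it. -/
theorem simulates_probe_and_lintegral_le {ω : Query n → ℝ≥0∞} (hω : ∀ c, ω c ≠ ∞)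
    {μ : Fin n → Measure Plane} [∀ i, IsFiniteMeasure (μ i)] (c : Query n) (y z : Tree n α)
    (cs : List (Query n)) (dec : List Bool → Option Bool) (i : Fin n)
    (hdec : ∀ bs P, List.Forall₂ (fun c b => P ∈ c.branch b) cs bs →
      ∀ b, dec bs = some b → P ∈ c.branch b)
    (heval : ∀ᵐ P ∂Measure.pi μ, ∀ b, dec (answers cs P) = some b → (b = true ↔ 0 < c.side P))
    (hres : ∀ P : Input n, (cs.map ω).sum * μ i Set.univ ≤
      ω c * μ i {x | dec (answers cs (Function.update P i x)) ≠ none}) :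
    (probe cs fun bs => resume c y z (dec bs)).Simulates (node c y z) ∧
      ∫⁻ P, (probe cs fun bs => resume c y z (dec bs)).weight ω P ∂Measure.pi μ ≤
        ∫⁻ P, (node c y z).weight ω P ∂Measure.pi μ := by
  constructor
  · rw [← simulatesOn_univ]
    refine simulatesOn_probe fun bs _ => ?_
    rcases h : dec bs with _ | b
    · exact SimulatesOn.refl _ _
    · refine SimulatesOn.of_subset_branch b (fun P hP => hdec bs P hP.2 b h) ?_
      cases b <;> exact SimulatesOn.refl _ _
  · let S : Set (Input n) := {P | dec (answers cs P) ≠ none}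
    have hS : MeasurableSet S := measurableSet_answers cs fun bs => dec bs ≠ none
    have h1 : ω c * Measure.pi μ S ≠ ∞ := ENNReal.mul_ne_top (hω c) (measure_ne_top _ _)
    have h2 := mul_measure_pi_le i hS _ _ hres
    -- With `ω c` added on the decided inputs `S`, the comparison becomes pointwise: a decided input
    -- skips `c`, an undecided one pays for `c` again, and both pay for the probe. By `h2`, the
    -- savings on `S` cover the probe.
    refine ENNReal.le_of_add_le_add_right h1 ?_
    calc _ = ∫⁻ P, (probe cs fun bs => resume c y z (dec bs)).weight ω P +
          S.indicator (fun _ => ω c) P ∂Measure.pi μ := by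
          rw [lintegral_add_right _ (measurable_const.indicator hS), lintegral_indicator_const hS]
      _ ≤ ∫⁻ P, (cs.map ω).sum + (node c y z).weight ω P ∂Measure.pi μ := by
          refine lintegral_mono_ae ?_
          filter_upwards [heval] with P hP
          rw [weight_probe, add_assoc]
          gcongr
          rcases h : dec (answers cs P) with _ | b
          · simp [S, h, resume]
          · have hb := hP b h
            have hPS : P ∈ S := by simp [S, h]
            rw [Set.indicator_of_mem hPS, add_comm]
            cases b
            · have : ¬ 0 < c.side P := by simpa using hb
              simp [resume, weight, this]
            · have : 0 < c.side P := by simpa using hb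
              simp [resume, weight, this]
      _ ≤ _ := by
          rw [lintegral_add_left measurable_const, lintegral_const, add_comm]
          gcongr

end Tree

namespace Query

/-- Weights that pay for the simulation of a query by queries of smaller weight. -/
def cost : Query n → ℝ≥0∞
  | fixed _ _ => 1
  | slope _ _ _ _ _ => 4
  | point _ _ _ _ _ => 8
  | pair _ _ _ _ _ _ => 72

theorem cost_ne_top (c : Query n) : c.cost ≠ ∞ := by
  cases c <;> simp [cost]

theorem one_le_cost (c : Query n) : 1 ≤ c.cost := by
  cases c <;> simp [cost]

theorem cost_le (c : Query n) : c.cost ≤ 72 := by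
  cases c <;> norm_num [cost]

end Query

theorem ContinuousDist.ae_side_fixed_ne {μ : Fin n → Measure Plane} [∀ i, IsFiniteMeasure (μ i)]
    (hμ : ∀ i, ContinuousDist (μ i)) (i : Fin n) (ℓ : DirLine) :
    ∀ᵐ P ∂Measure.pi μ, (Query.fixed i ℓ).side P ≠ 0 :=
  Measure.tendsto_eval_ae_ae.eventually ((hμ i).ae_cross_ne ℓ.dir_ne ℓ.base)

namespace Tree

variable {μ : Fin n → Measure Plane} [∀ i, IsFiniteMeasure (μ i)]

/-- If the parallel halving line for `p_i` separates `p_i` from `p_j`, then `p_i` lies on the same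
side of the line through `p_j` as of the halving line. Given `p_j`, this has probability at least
1/2. -/
theorem exists_simulation_slope (hμ : ∀ i, ContinuousDist (μ i)) (i j : Fin n) (hij : i ≠ j)
    (u : Plane) (hu : u ≠ 0) (y z : Tree n α) :
    ∃ (j' : Fin n) (ℓ : DirLine) (y' z' : Tree n α),
      (node (.fixed j' ℓ) y' z').Simulates (node (.slope i j hij u hu) y z) ∧
      ∫⁻ P, (node (.fixed j' ℓ) y' z').weight Query.cost P ∂Measure.pi μ ≤
        ∫⁻ P, (node (.slope i j hij u hu) y z).weight Query.cost P ∂Measure.pi μ := by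
  obtain ⟨ℓ, rfl, hl, hr⟩ := exists_halving_line (μ i) (hμ i) u hu
  let dec : List Bool → Option Bool
    | [a, b] => if a = b then none else some a
    | _ => none
  have hdec : ∀ bs P, List.Forall₂ (fun (c : Query n) b => P ∈ c.branch b)
      [.fixed i ℓ, .fixed j ℓ] bs → ∀ b, dec bs = some b →
      P ∈ (Query.slope i j hij ℓ.dir hu).branch b := by
    intro bs P h b hb
    simp only [List.forall₂_cons_left_iff, List.forall₂_nil_left_iff] at h
    obtain ⟨a₁, _, h₁, ⟨a₂, _, h₂, rfl, rfl⟩, rfl⟩ := h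
    cases a₁ <;> cases a₂ <;> simp only [dec, Bool.false_eq_true, Bool.true_eq_false, if_true,
      if_false, Option.some.injEq, reduceCtorEq] at hb <;> subst hb <;>
      simp only [Query.mem_branch_true, Query.mem_branch_false, Query.side, cross, Prod.fst_sub,
        Prod.snd_sub] at h₁ h₂ ⊢ <;> linarith
  refine ⟨_, _, _, _, simulates_probe_and_lintegral_le Query.cost_ne_top _ y z
    [.fixed i ℓ, .fixed j ℓ] dec i hdec ?_ fun P => ?_⟩
  · filter_upwards [ContinuousDist.ae_side_fixed_ne hμ i ℓ,
      ContinuousDist.ae_side_fixed_ne hμ j ℓ] with P h₁ h₂ b hb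
    have := hdec _ P (forall₂_answers (by simp [h₁, h₂])) b hb
    cases b <;> simp at this ⊢ <;> linarith
  · have hle : μ i Set.univ ≤ 2 * μ i {x | dec (answers [Query.fixed i ℓ, .fixed j ℓ]
        (Function.update P i x)) ≠ none} := by
      by_cases hj : 0 < cross ℓ.dir (P j - ℓ.base)
      · rw [← hr]
        gcongr
        intro x (hx : cross _ _ < 0)
        simp [dec, answers, Query.side, hij.symm, hj, hx.le]
      · rw [← hl]
        gcongr
        intro x (hx : 0 < cross _ _)
        simp [dec, answers, Query.side, hij.symm, hj, hx]
    calc _ = 2 * μ i Set.univ := by norm_num [Query.cost]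
      _ ≤ 2 * (2 * _) := by gcongr
      _ = _ := by rw [← mul_assoc]; norm_num [Query.cost]

theorem exists_simulation_point (hμ : ∀ i, ContinuousDist (μ i)) (i j : Fin n) (hij : i ≠ j)
    (q : Plane) (b : Bool) (y z : Tree n α) :
    ∃ (j' : Fin n) (ℓ : DirLine) (y' z' : Tree n α),
      (node (.fixed j' ℓ) y' z').Simulates (node (.point i j hij q b) y z) ∧
      ∫⁻ P, (node (.fixed j' ℓ) y' z').weight Query.cost P ∂Measure.pi μ ≤
        ∫⁻ P, (node (.point i j hij q b) y z).weight Query.cost P ∂Measure.pi μ := by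
  obtain ⟨t, hw, hw'⟩ := exists_halving_wedge (μ i) (hμ i) q
  let e : DirLine := ⟨q, (1, 0), by simp⟩
  let d : DirLine := ⟨q, (-t, 1), by simp⟩
  let dec : List Bool → Option Bool
    -- `xi == yi` names the double wedge of `p_i`. The answer is the sign of the first term in `hs`
    -- below, reversed if the line is directed towards `q`.
    | [xi, yi, xj, yj] => if (xi == yi) = (xj == yj) then none else some ((xj == yi) == b)
    | _ => none
  have hdec : ∀ bs P, List.Forall₂ (fun (c : Query n) b => P ∈ c.branch b)
      [.fixed i e, .fixed i d, .fixed j e, .fixed j d] bs → ∀ b', dec bs = some b' →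
      P ∈ (Query.point i j hij q b).branch b' := by
    intro bs P h b' hb
    simp only [List.forall₂_cons_left_iff, List.forall₂_nil_left_iff] at h
    obtain ⟨a₁, _, h₁, ⟨a₂, _, h₂, ⟨a₃, _, h₃, ⟨a₄, _, h₄, rfl, rfl⟩, rfl⟩, rfl⟩, rfl⟩ := h
    -- The directions of `e` and `d` have determinant 1, so the orientation is a 2×2 determinant of
    -- sides. In different double wedges its two terms have the same sign.
    have hs : (Query.point i j hij q b).side P = (if b = true then 1 else -1) *
        ((Query.fixed j e).side P * (Query.fixed i d).side P -
          (Query.fixed j d).side P * (Query.fixed i e).side P) := by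
      cases b <;> simp only [Query.side, cross, e, d, Prod.fst_sub, Prod.snd_sub, if_true,
        Bool.false_eq_true, if_false] <;> ring
    simp only [Query.mem_branch_iff] at h₁ h₂ h₃ h₄
    simp only [dec] at hb
    split_ifs at hb with hne
    rw [Option.some.injEq] at hb
    have hsum : HasSign (a₃ == a₂) ((Query.fixed j e).side P * (Query.fixed i d).side P -
        (Query.fixed j d).side P * (Query.fixed i e).side P) := by
      have key : ∀ a₁ a₂ a₃ a₄ : Bool, ¬(a₁ == a₂) = (a₃ == a₄) → (!(a₄ == a₁)) = (a₃ == a₂) := by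
        decide
      rw [sub_eq_add_neg]
      exact (h₃.mul h₂).add (key a₁ a₂ a₃ a₄ hne ▸ (h₄.mul h₁).neg)
    rw [Query.mem_branch_iff, hs, ← hb]
    cases b
    · simpa using hsum.neg
    · simpa using hsum
  refine ⟨_, _, _, _, simulates_probe_and_lintegral_le Query.cost_ne_top _ y z
    [.fixed i e, .fixed i d, .fixed j e, .fixed j d] dec i hdec ?_ fun P => ?_⟩
  · filter_upwards [ContinuousDist.ae_side_fixed_ne hμ i e, ContinuousDist.ae_side_fixed_ne hμ i d,
      ContinuousDist.ae_side_fixed_ne hμ j e,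
      ContinuousDist.ae_side_fixed_ne hμ j d] with P h₁ h₂ h₃ h₄ b hb
    have := hdec _ P (forall₂_answers (by simp [h₁, h₂, h₃, h₄])) b hb
    cases b <;> simp at this ⊢ <;> linarith
  · have hle : μ i Set.univ ≤ 2 * μ i {x | dec (answers [Query.fixed i e, .fixed i d,
        .fixed j e, .fixed j d] (Function.update P i x)) ≠ none} := by
      have hae : ∀ᵐ x ∂μ i, (decide (0 < cross (1, 0) (x - q)) ==
          decide (0 < cross (-t, 1) (x - q))) =
            decide (0 < cross (1, 0) (x - q) * cross (-t, 1) (x - q)) := by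
        filter_upwards [(hμ i).ae_cross_ne (u := (1, 0)) (by simp) q,
          (hμ i).ae_cross_ne (u := (-t, 1)) (by simp) q] with x h₁ h₂
        rcases lt_or_gt_of_ne h₁ with h₁ | h₁ <;> rcases lt_or_gt_of_ne h₂ with h₂ | h₂
        · simp [mul_pos_of_neg_of_neg h₁ h₂, h₁.not_gt, h₂.not_gt]
        · simp [(mul_neg_of_neg_of_pos h₁ h₂).not_gt, h₁.not_gt, h₂]
        · simp [(mul_neg_of_pos_of_neg h₁ h₂).not_gt, h₁, h₂.not_gt]
        · simp [mul_pos h₁ h₂, h₁, h₂]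
      have hset : ∀ x, dec (answers [Query.fixed i e, .fixed i d, .fixed j e, .fixed j d]
          (Function.update P i x)) ≠ none ↔
          ¬ ((decide (0 < cross (1, 0) (x - q)) == decide (0 < cross (-t, 1) (x - q))) =
            (decide (0 < cross (1, 0) (P j - q)) == decide (0 < cross (-t, 1) (P j - q)))) := by
        intro x
        simp [dec, answers, Query.side, hij.symm, e, d]
      simp only [hset]
      rcases (decide (0 < cross (1, 0) (P j - q)) ==
        decide (0 < cross (-t, 1) (P j - q))).eq_false_or_eq_true with h | h
      · rw [h, ← hw']
        gcongr 2 * ?_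
        refine measure_mono_ae ?_
        filter_upwards [hae] with x hx hx'
        change ¬ (_ = true)
        rw [hx, decide_eq_true_eq]
        exact hx'
      · rw [h, ← hw]
        gcongr 2 * ?_
        refine measure_mono_ae ?_
        filter_upwards [hae] with x hx hx'
        change ¬ (_ = false)
        rw [hx, decide_eq_false_iff_not, not_not]
        exact hx'
    calc _ = 4 * μ i Set.univ := by norm_num [Query.cost]
      _ ≤ 4 * (2 * _) := by gcongr
      _ = _ := by rw [← mul_assoc]; norm_num [Query.cost]

/-- The side of `p_i` is affine in `p_i`, with value `cq` at the quartering point `q`. The query is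
decided in the wedge where both coordinate terms have the sign of `cq`. The new root is a point
query, which can be replaced in turn. -/
theorem exists_simulation_pair (hμ : ∀ i, ContinuousDist (μ i)) (i j k : Fin n) (hij : i ≠ j)
    (hik : i ≠ k) (hjk : j ≠ k) (y z : Tree n α) :
    ∃ (i' j' : Fin n) (hij' : i' ≠ j') (q : Plane) (b : Bool) (y' z' : Tree n α),
      (node (.point i' j' hij' q b) y' z').Simulates (node (.pair i j k hij hik hjk) y z) ∧
      ∫⁻ P, (node (.point i' j' hij' q b) y' z').weight Query.cost P ∂Measure.pi μ ≤
        ∫⁻ P, (node (.pair i j k hij hik hjk) y z).weight Query.cost P ∂Measure.pi μ := by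
  obtain ⟨q, s, hq⟩ := exists_quartering (μ i) (hμ i)
  let e : DirLine := ⟨q, (0, -1), by simp⟩
  let d : DirLine := ⟨q, (1, s), by simp⟩
  let cq : Query n := .point k j hjk.symm q true
  let c₁ : Query n := .slope j k hjk (1, s) (by simp)
  let c₂ : Query n := .slope j k hjk (0, 1) (by simp)
  let dec : List Bool → Option Bool
    | [b, b₁, b₂, a₁, a₂] => if a₁ = (b₁ == b) ∧ a₂ = (b₂ == b) then some b else none
    | _ => none
  have hs : ∀ P, (Query.pair i j k hij hik hjk).side P = (Query.fixed i e).side P * c₁.side P +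
      (Query.fixed i d).side P * c₂.side P + cq.side P := fun P => by
    simp only [Query.side, cross, e, d, cq, c₁, c₂, Prod.fst_sub, Prod.snd_sub]
    ring
  have hdec : ∀ bs P, List.Forall₂ (fun (c : Query n) b => P ∈ c.branch b)
      [cq, c₁, c₂, .fixed i e, .fixed i d] bs → ∀ b', dec bs = some b' →
      P ∈ (Query.pair i j k hij hik hjk).branch b' := by
    intro bs P h b' hb
    simp only [List.forall₂_cons_left_iff, List.forall₂_nil_left_iff] at h
    obtain ⟨b, _, h, ⟨b₁, _, h₁, ⟨b₂, _, h₂, ⟨a₁, _, h₃, ⟨a₂, _, h₄, rfl, rfl⟩, rfl⟩, rfl⟩, rfl⟩,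
      rfl⟩ := h
    simp only [Query.mem_branch_iff] at h h₁ h₂ h₃ h₄ ⊢
    simp only [dec] at hb
    split_ifs at hb with hab
    obtain ⟨rfl, rfl⟩ := hab
    rw [Option.some.injEq] at hb
    subst hb
    have hb : ∀ b₁ b : Bool, ((b₁ == b) == b₁) = b := by decide
    rw [hs]
    exact ((hb b₁ b ▸ h₃.mul h₁).add (hb b₂ b ▸ h₄.mul h₂)).add h
  refine ⟨_, _, _, _, _, _, _, simulates_probe_and_lintegral_le Query.cost_ne_top _ y z
    [cq, c₁, c₂, .fixed i e, .fixed i d] dec i hdec (ae_of_all _ fun P b hb => ?_) fun P => ?_⟩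
  -- Evaluation counts zero as a negative answer. Weak inequalities for the two products suffice,
  -- because the third term carries the strictness, so no null set has to be discarded.
  · have key : ∀ {x y : ℝ}, decide (0 < x) = (decide (0 < y) == b) →
        if b = true then 0 ≤ x * y else x * y ≤ 0 := by
      intro x y h
      by_cases hx : 0 < x <;> by_cases hy : 0 < y <;> cases b <;> simp [hx, hy] at h ⊢ <;>
        nlinarith
    simp only [answers, List.map_cons, List.map_nil, dec] at hb
    split_ifs at hb with hab
    rw [Option.some.injEq] at hb
    rw [hb] at hab
    have k₁ := key hab.1
    have k₂ := key hab.2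
    rw [hs]
    cases b
    · simp only [decide_eq_false_iff_not, not_lt] at hb
      simp only [Bool.false_eq_true, if_false, false_iff, not_lt] at k₁ k₂ ⊢
      linarith
    · simp only [decide_eq_true_eq] at hb
      simp only [if_true, true_iff] at k₁ k₂ ⊢
      linarith
  -- The favourable wedge depends only on `p_j` and `p_k`, so `p_i` has a quarter of its mass there
  -- in every case.
  · have h := hq (decide (0 < c₁.side P) == decide (0 < cq.side P))
      (decide (0 < c₂.side P) == decide (0 < cq.side P))
    have hle : {p | decide (0 < cross (0, -1) (p - q)) =
          (decide (0 < c₁.side P) == decide (0 < cq.side P)) ∧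
        decide (0 < cross (1, s) (p - q)) =
          (decide (0 < c₂.side P) == decide (0 < cq.side P))} ⊆
        {x | dec (answers [cq, c₁, c₂, .fixed i e, .fixed i d] (Function.update P i x)) ≠
          none} := by
      rintro x ⟨hx, hx'⟩
      simp only [Query.side, cq, c₁, c₂] at hx hx'
      simp only [dec, answers, Query.side, cq, c₁, c₂, e, d, List.map_cons, List.map_nil,
        Function.update_of_ne hij.symm, Function.update_of_ne hik.symm, Function.update_self,
        Set.mem_ofPred_eq]
      rw [if_pos ⟨hx, hx'⟩]
      simp
    have hle' := h.ge.trans (mul_le_mul_right (measure_mono hle) 4)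
    calc _ = 18 * μ i Set.univ := by norm_num [Query.cost, cq, c₁, c₂]
      _ ≤ 18 * (4 * _) := by gcongr
      _ = _ := by rw [← mul_assoc]; norm_num [Query.cost]

end Tree

end LinComp

/-! ### From linear comparison trees to restricted trees, by induction on the depth. -/

namespace LinComp

variable {n : ℕ} {α : Type*}

namespace Tree

theorem lintegral_weight_node {ω : Query n → ℝ≥0∞} {ν : Measure (Input n)} {c : Query n}
    (hc : ∀ᵐ P ∂ν, c.side P ≠ 0) (y z : Tree n α) :
    ∫⁻ P, (node c y z).weight ω P ∂ν = ω c * ν Set.univ +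
      (∫⁻ P in c.branch true, y.weight ω P ∂ν + ∫⁻ P in c.branch false, z.weight ω P ∂ν) := by
  have hcompl : ((c.branch true)ᶜ : Set (Input n)) =ᵐ[ν] c.branch false := by
    refine Filter.eventuallyEq_set.2 ?_
    filter_upwards [hc] with P hP
    simp [hP.le_iff_lt]
  have h₁ : ∫⁻ P in c.branch true, (node c y z).weight ω P ∂ν =
      ∫⁻ P in c.branch true, ω c + y.weight ω P ∂ν :=
    setLIntegral_congr_fun (c.measurableSet_branch true) fun P hP => by
      simp [weight, (c.mem_branch_true P).1 hP]
  have h₂ : ∫⁻ P in c.branch false, (node c y z).weight ω P ∂ν =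
      ∫⁻ P in c.branch false, ω c + z.weight ω P ∂ν :=
    setLIntegral_congr_fun (c.measurableSet_branch false) fun P hP => by
      simp [weight, ((c.mem_branch_false P).1 hP).not_gt]
  rw [← lintegral_add_compl _ (c.measurableSet_branch true), setLIntegral_congr hcompl, h₁, h₂,
    lintegral_add_left measurable_const, lintegral_add_left measurable_const, setLIntegral_const,
    setLIntegral_const, ← measure_add_measure_compl (c.measurableSet_branch true),
    measure_congr hcompl]
  ring

variable {D : Fin n → Measure Plane} [∀ i, IsProbabilityMeasure (D i)]

theorem setLIntegral_weight_node (hD : ∀ i, ContinuousDist (D i)) (ω : Query n → ℝ≥0∞)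
    (G : Set (Input n)) (j : Fin n) (ℓ : DirLine) (y z : Tree n α) :
    ∫⁻ P in G, (node (.fixed j ℓ) y z).weight ω P ∂Measure.pi D =
      ω (.fixed j ℓ) * Measure.pi D G +
        (∫⁻ P in G ∩ (Query.fixed j ℓ).branch true, y.weight ω P ∂Measure.pi D +
          ∫⁻ P in G ∩ (Query.fixed j ℓ).branch false, z.weight ω P ∂Measure.pi D) := by
  rw [lintegral_weight_node (ae_restrict_of_ae (ContinuousDist.ae_side_fixed_ne hD j ℓ)),
    Measure.restrict_restrict (Query.measurableSet_branch _ _),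
    Measure.restrict_restrict (Query.measurableSet_branch _ _), Measure.restrict_apply_univ,
    Set.inter_comm G, Set.inter_comm G]

/-- On the product of the cells `R`, some tree that queries only fixed lines at depth less than `m`
simulates `T`, and its expected depth is at most the expected cost of `T`. -/
def RestrictsAtCost (D : Fin n → Measure Plane) (m : ℕ) (R : Fin n → Set Plane) (T : Tree n α) :
    Prop :=
  ∃ T' : Tree n α, T'.RestrictedTo m ∧ SimulatesOn (Set.univ.pi R) T' T ∧
    ∫⁻ P in Set.univ.pi R, T'.weight (fun _ => 1) P ∂Measure.pi D ≤
      ∫⁻ P in Set.univ.pi R, T.weight Query.cost P ∂Measure.pi D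

/-- The replacements are made for product measures; the input distribution restricted to a product
of cells is the product of the restrictions. -/
theorem RestrictsAtCost.of_simulates {m : ℕ} {R : Fin n → Set Plane} {S T : Tree n α}
    (hS : S.RestrictsAtCost D m R) (h : S.Simulates T)
    (hle : ∫⁻ P, S.weight Query.cost P ∂Measure.pi (fun i => (D i).restrict (R i)) ≤
      ∫⁻ P, T.weight Query.cost P ∂Measure.pi (fun i => (D i).restrict (R i))) :
    T.RestrictsAtCost D m R := by
  obtain ⟨T', hT', hsim, hle'⟩ := hS
  rw [← Measure.restrict_pi_pi D R] at hle
  exact ⟨T', hT', hsim.trans ((simulatesOn_univ.2 h).mono (Set.subset_univ _)), hle'.trans hle⟩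

/-- The induction is on the depth bound and not on the tree, because undecided queries reappear in
the subtrees. At bound `0` the tree is kept, since each query costs at least 1. -/
theorem restrictsAtCost (hD : ∀ i, ContinuousDist (D i)) (m : ℕ) (R : Fin n → Set Plane)
    (T : Tree n α) : T.RestrictsAtCost D m R := by
  induction m generalizing T R with
  | zero =>
    exact ⟨T, restrictedTo_zero T, SimulatesOn.refl _ _,
      lintegral_mono (weight_mono Query.one_le_cost T)⟩
  | succ m ih =>
    have hfixed : ∀ (j : Fin n) (ℓ : DirLine) (y z : Tree n α),
        (node (.fixed j ℓ) y z).RestrictsAtCost D (m + 1) R := by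
      intro j ℓ y z
      obtain ⟨y', hy, hys, hyc⟩ := ih (fun i => R i ∩ (Query.fixed j ℓ).cut true i) y
      obtain ⟨z', hz, hzs, hzc⟩ := ih (fun i => R i ∩ (Query.fixed j ℓ).cut false i) z
      rw [Query.pi_inter_cut] at hys hyc hzs hzc
      refine ⟨node (.fixed j ℓ) y' z', restrictedTo_succ_node.2 ⟨⟨j, ℓ, rfl⟩, hy, hz⟩,
        .node (.of_subset_branch true Set.inter_subset_right hys)
          (.of_subset_branch false Set.inter_subset_right hzs), ?_⟩
      rw [setLIntegral_weight_node hD, setLIntegral_weight_node hD]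
      exact add_le_add le_rfl (add_le_add hyc hzc)
    have hcont : ∀ i, ContinuousDist ((D i).restrict (R i)) := fun i => (hD i).restrict _
    have hpoint : ∀ (i j : Fin n) (hij : i ≠ j) (q : Plane) (b : Bool) (y z : Tree n α),
        (node (.point i j hij q b) y z).RestrictsAtCost D (m + 1) R := by
      intro i j hij q b y z
      obtain ⟨_, _, _, _, hS, hle⟩ := exists_simulation_point hcont i j hij q b y z
      exact (hfixed _ _ _ _).of_simulates hS hle
    rcases T with a | ⟨c, y, z⟩
    · exact ⟨leaf a, restrictedTo_leaf _ a, SimulatesOn.refl _ _, by simp [weight]⟩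
    rcases c with ⟨j, ℓ⟩ | ⟨i, j, hij, u, hu⟩ | ⟨i, j, hij, q, b⟩ | ⟨i, j, k, hij, hik, hjk⟩
    · exact hfixed j ℓ y z
    · obtain ⟨_, _, _, _, hS, hle⟩ := exists_simulation_slope hcont i j hij u hu y z
      exact (hfixed _ _ _ _).of_simulates hS hle
    · exact hpoint i j hij q b y z
    · obtain ⟨_, _, _, _, _, _, _, hS, hle⟩ := exists_simulation_pair hcont i j k hij hik hjk y z
      exact (hpoint _ _ _ _ _ _ _).of_simulates hS hle

theorem exists_restricted (hD : ∀ i, ContinuousDist (D i)) (T : Tree n α) :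
    ∃ T' : Tree n α, T'.Restricted ∧ T'.Simulates T ∧
      T'.expectedDepth D ≤ 72 * T.expectedDepth D := by
  obtain ⟨T', hT', hsim, hle⟩ := restrictsAtCost hD (n ^ 2 + 1) (fun _ => Set.univ) T
  rw [Set.pi_univ] at hsim hle
  refine ⟨T', restricted_iff.2 hT', simulatesOn_univ.1 hsim, ?_⟩
  rw [expectedDepth_eq, expectedDepth_eq, ← lintegral_const_mul' _ _ (by simp)]
  rw [Measure.restrict_univ] at hle
  exact hle.trans (lintegral_mono (weight_le_mul Query.cost_le T))

/-! ### From restricted to entropy-sensitive trees. -/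

theorem measure_pi_inter_branch_eq {R : Fin n → Set Plane} {j : Fin n} {ℓ : DirLine}
    (h : IsHalving (D j) ℓ (R j)) :
    Measure.pi D (Set.univ.pi R ∩ (Query.fixed j ℓ).branch true) =
      Measure.pi D (Set.univ.pi R ∩ (Query.fixed j ℓ).branch false) := by
  rw [← Query.pi_inter_cut, ← Query.pi_inter_cut, Measure.pi_pi, Measure.pi_pi]
  refine Finset.prod_congr rfl fun i _ => ?_
  by_cases hi : i = j
  · subst hi
    simpa [Query.cut, IsHalving, Set.inter_comm] using h
  · simp [Query.cut, hi]

theorem measure_inter_branch_add (hD : ∀ i, ContinuousDist (D i)) (G : Set (Input n)) (j : Fin n)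
    (ℓ : DirLine) :
    Measure.pi D (G ∩ (Query.fixed j ℓ).branch true) +
      Measure.pi D (G ∩ (Query.fixed j ℓ).branch false) = Measure.pi D G := by
  rw [← measure_inter_add_sdiff G ((Query.fixed j ℓ).measurableSet_branch true)]
  congr 1
  refine measure_congr (Filter.eventuallyEq_set.2 ?_)
  filter_upwards [ContinuousDist.ae_side_fixed_ne hD j ℓ] with P hP
  simp [hP.le_iff_lt]

omit [∀ i, IsProbabilityMeasure (D i)] in
theorem setLIntegral_weight_node_of_subset (ω : Query n → ℝ≥0∞) {G : Set (Input n)}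
    (hG : MeasurableSet G) {c : Query n} {b : Bool} (h : G ⊆ c.branch b) (y z : Tree n α) :
    ∫⁻ P in G, (node c y z).weight ω P ∂Measure.pi D = ω c * Measure.pi D G +
      ∫⁻ P in G, (if b = true then y else z).weight ω P ∂Measure.pi D := by
  rw [← setLIntegral_const, ← lintegral_add_left measurable_const]
  refine setLIntegral_congr_fun hG fun P hP => ?_
  cases b
  · simp [weight, ((c.mem_branch_false P).1 (h hP)).not_gt]
  · simp [weight, (c.mem_branch_true P).1 (h hP)]

/-- Parallel lines of the same direction are nested. -/
theorem branch_subset_of_dir_eq (j : Fin n) {h ℓ : DirLine} (hdir : h.dir = ℓ.dir) :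
    ∃ b : Bool, (Query.fixed j h).branch b ⊆ (Query.fixed j ℓ).branch b := by
  obtain ⟨q, u, hu⟩ := h
  obtain rfl : u = ℓ.dir := hdir
  rcases le_total (cross ℓ.dir ℓ.base) (cross ℓ.dir q) with hq | hq
  · refine ⟨true, fun P hP => ?_⟩
    simp only [Query.mem_branch_true, Query.side, cross, Prod.fst_sub, Prod.snd_sub] at *
    linarith
  · refine ⟨false, fun P hP => ?_⟩
    simp only [Query.mem_branch_false, Query.side, cross, Prod.fst_sub, Prod.snd_sub] at *
    linarith

theorem exists_halvingTo (hD : ∀ i, ContinuousDist (D i)) (m : ℕ) (R : Fin n → Set Plane)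
    (hR : ∀ i, MeasurableSet (R i)) (T : Tree n α) (hT : T.RestrictedTo m) :
    ∃ T' : Tree n α, T'.RestrictedTo m ∧ T'.HalvingTo D m R ∧
      SimulatesOn (Set.univ.pi R) T' T ∧
      ∫⁻ P in Set.univ.pi R, T'.weight (fun _ => 1) P ∂Measure.pi D ≤
        2 * ∫⁻ P in Set.univ.pi R, T.weight (fun _ => 1) P ∂Measure.pi D := by
  induction m generalizing T R with
  | zero =>
    refine ⟨T, hT, halvingTo_zero D R T, SimulatesOn.refl _ _, ?_⟩
    exact le_mul_of_one_le_left' one_le_two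
  | succ m ih =>
    rcases T with a | ⟨c, y, z⟩
    · exact ⟨leaf a, hT, halvingTo_leaf D _ R a, SimulatesOn.refl _ _, by simp [weight]⟩
    obtain ⟨⟨j, ℓ, rfl⟩, hy, hz⟩ := restrictedTo_succ_node.1 hT
    obtain ⟨h, hdir, hl, hr⟩ := exists_halving_line ((D j).restrict (R j)) ((hD j).restrict _)
      ℓ.dir ℓ.dir_ne
    have hhalf : IsHalving (D j) h (R j) := by
      rw [IsHalving, ← Measure.restrict_apply h.measurableSet_left,
        ← Measure.restrict_apply h.measurableSet_right]
      exact (ENNReal.mul_right_inj two_ne_zero ENNReal.ofNat_ne_top).1 (hl.trans hr.symm)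
    have hRm : ∀ b i, MeasurableSet (R i ∩ (Query.fixed j h).cut b i) := fun b i =>
      (hR i).inter (Query.measurableSet_cut _ _ _)
    have hG : MeasurableSet (Set.univ.pi R) := MeasurableSet.univ_pi hR
    have hGb : ∀ b, MeasurableSet (Set.univ.pi R ∩ (Query.fixed j h).branch b) := fun b =>
      hG.inter (Query.measurableSet_branch _ _)
    have hadd := measure_inter_branch_add hD (Set.univ.pi R) j h
    have heq := measure_pi_inter_branch_eq hhalf
    obtain ⟨b, hb⟩ := branch_subset_of_dir_eq j hdir
    -- On the branch `b` the old query is decided and dropped, which frees twice the mass of the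
    -- branch from the doubled budget. On the other branch the whole tree is processed again.
    have key : ∀ b' : Bool, ∃ A : Tree n α, A.RestrictedTo m ∧
        A.HalvingTo D m (fun i => R i ∩ (Query.fixed j h).cut b' i) ∧
        SimulatesOn (Set.univ.pi R ∩ (Query.fixed j h).branch b') A (node (.fixed j ℓ) y z) ∧
        ∫⁻ P in Set.univ.pi R ∩ (Query.fixed j h).branch b', A.weight (fun _ => 1) P
            ∂Measure.pi D +
          (if b' = b then 2 * Measure.pi D (Set.univ.pi R ∩ (Query.fixed j h).branch b') else 0) ≤
        2 * ∫⁻ P in Set.univ.pi R ∩ (Query.fixed j h).branch b',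
          (node (.fixed j ℓ) y z).weight (fun _ => 1) P ∂Measure.pi D := by
      intro b'
      by_cases hbb : b' = b
      · subst hbb
        have hsub : Set.univ.pi R ∩ (Query.fixed j h).branch b' ⊆ (Query.fixed j ℓ).branch b' :=
          Set.inter_subset_right.trans hb
        obtain ⟨A, hA, hAh, hAs, hAc⟩ :=
          ih (fun i => R i ∩ (Query.fixed j h).cut b' i) (hRm b') (if b' = true then y else z)
            (by split_ifs <;> assumption)
        rw [Query.pi_inter_cut] at hAs hAc
        refine ⟨A, hA, hAh, .of_subset_branch b' hsub hAs, ?_⟩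
        rw [setLIntegral_weight_node_of_subset _ (hGb b') hsub, if_pos rfl, one_mul, mul_add,
          add_comm]
        exact add_le_add le_rfl hAc
      · obtain ⟨A, hA, hAh, hAs, hAc⟩ :=
          ih (fun i => R i ∩ (Query.fixed j h).cut b' i) (hRm b') _ (hT.mono m.le_succ)
        rw [Query.pi_inter_cut] at hAs hAc
        exact ⟨A, hA, hAh, hAs, by rwa [if_neg hbb, add_zero]⟩
    obtain ⟨A, hA, hAh, hAs, hAc⟩ := key true
    obtain ⟨B, hB, hBh, hBs, hBc⟩ := key false
    refine ⟨node (.fixed j h) A B, restrictedTo_succ_node.2 ⟨⟨j, h, rfl⟩, hA, hB⟩,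
      .node hhalf hAh hBh, .node hAs hBs, ?_⟩
    have hsum := add_le_add hAc hBc
    rw [← mul_add, add_add_add_comm] at hsum
    rw [setLIntegral_weight_node hD, one_mul, add_comm]
    -- Both branches have half of the mass, so the freed amount is exactly the price of the new
    -- query.
    refine le_trans (le_of_eq ?_) (hsum.trans ?_)
    · congr 1
      cases b
      · simp [← hadd, heq, two_mul]
      · simp [← hadd, heq, two_mul]
    · rw [← lintegral_union (hGb false)]
      · gcongr 2 * ?_
        exact lintegral_mono_set (Set.union_subset Set.inter_subset_left Set.inter_subset_left)
      · exact Set.disjoint_left.2 fun P hP hP' =>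
          lt_asymm ((Query.mem_branch_true _ _).1 hP.2) ((Query.mem_branch_false _ _).1 hP'.2)

theorem exists_entropySensitive (hD : ∀ i, ContinuousDist (D i)) (T : Tree n α)
    (hT : T.Restricted) :
    ∃ T' : Tree n α, T'.EntropySensitive D ∧ T'.Simulates T ∧
      T'.expectedDepth D ≤ 2 * T.expectedDepth D := by
  obtain ⟨T', hT', hhalf, hsim, hle⟩ := exists_halvingTo hD (n ^ 2 + 1) (fun _ => Set.univ)
    (fun _ => MeasurableSet.univ) T (restricted_iff.1 hT)
  rw [Set.pi_univ] at hsim hle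
  refine ⟨T', entropySensitive_iff.2 ⟨hT', hhalf⟩, simulatesOn_univ.1 hsim, ?_⟩
  rw [expectedDepth_eq, expectedDepth_eq]
  rwa [Measure.restrict_univ] at hle

theorem Simulates.trans {T₁ T₂ T₃ : Tree n α} (h₁ : T₁.Simulates T₂) (h₂ : T₂.Simulates T₃) :
    T₁.Simulates T₃ :=
  simulatesOn_univ.1 ((simulatesOn_univ.2 h₁).trans (simulatesOn_univ.2 h₂))

end Tree

end LinComp

theorem mainTheorem3 :
    ∃ C : ℝ≥0, ∀ (n : ℕ) (D : Fin n → Measure LinComp.Plane),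
      (∀ i, IsProbabilityMeasure (D i)) → (∀ i, LinComp.ContinuousDist (D i)) →
      ∀ α : Type*,
        -- from linear comparison trees to restricted trees
        (∀ T : LinComp.Tree n α, T.height ≤ n ^ 2 →
          ∃ T' : LinComp.Tree n α, T'.Restricted ∧ T'.Simulates T ∧
            T'.expectedDepth D ≤ C * T.expectedDepth D) ∧
        -- from restricted trees to entropy-sensitive trees
        (∀ T : LinComp.Tree n α, T.Restricted →
          ∃ T' : LinComp.Tree n α, T'.EntropySensitive D ∧ T'.Simulates T ∧
            T'.expectedDepth D ≤ C * T.expectedDepth D) ∧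
        -- from linear comparison trees, through restricted trees, to entropy-sensitive trees
        (∀ T : LinComp.Tree n α, T.height ≤ n ^ 2 →
          ∃ T₁ T' : LinComp.Tree n α,
            T₁.Restricted ∧ T₁.Simulates T ∧
              T₁.expectedDepth D ≤ C * T.expectedDepth D ∧
            T'.EntropySensitive D ∧ T'.Simulates T₁ ∧ T'.Simulates T ∧
              T'.expectedDepth D ≤ C * T.expectedDepth D) := by
  -- The product of the factors 72 and 2 of the two transformations.
  refine ⟨144, fun n D hD hc α => ?_⟩
  have h₁ : ∀ T : LinComp.Tree n α, 72 * T.expectedDepth D ≤ 144 * T.expectedDepth D :=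
    fun T => by gcongr; norm_num
  have h₂ : ∀ T : LinComp.Tree n α, 2 * T.expectedDepth D ≤ 144 * T.expectedDepth D :=
    fun T => by gcongr; norm_num
  simp only [ENNReal.coe_ofNat]
  refine ⟨fun T _ => ?_, fun T hT => ?_, fun T _ => ?_⟩
  · obtain ⟨T', hT', hsim, hle⟩ := LinComp.Tree.exists_restricted hc T
    exact ⟨T', hT', hsim, hle.trans (h₁ T)⟩
  · obtain ⟨T', hT', hsim, hle⟩ := LinComp.Tree.exists_entropySensitive hc T hT
    exact ⟨T', hT', hsim, hle.trans (h₂ T)⟩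
  · obtain ⟨T₁, hT₁, hsim₁, hle₁⟩ := LinComp.Tree.exists_restricted hc T
    obtain ⟨T', hT', hsim', hle'⟩ := LinComp.Tree.exists_entropySensitive hc T₁ hT₁
    refine ⟨T₁, T', hT₁, hsim₁, hle₁.trans (h₁ T), hT', hsim', hsim'.trans hsim₁, ?_⟩
    calc T'.expectedDepth D ≤ 2 * (72 * T.expectedDepth D) := hle'.trans (by gcongr)
      _ = 144 * T.expectedDepth D := by rw [← mul_assoc]; norm_num
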